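/- Let $d,s,q\ge 0$ and $\ell,p\ge 1$ be integers, $\Theta_1\subset\mathbb R^\ell$, $\Theta_2\subset\mathbb R^p$, $\rho_0\in\Theta_1$, $\theta_0\in\Theta_2$. Let $(Y_i,X_i)_{i\in\mathbb Z}$ be a stationary and ergodic sequence in $\mathbb R\times\mathbb R^d$ with finite second and third moments, put $Z_i=(Y_{i-1},\dots,Y_{i-s},X_i,X_{i-1},\dots,X_{i-q})$, and assume the null hypothesis $$Y_i=m(\rho_0,Z_i)+\sigma(\theta_0,Z_i)\,\epsilon_i ,$$ where $m(\rho,\cdot)$ $(\rho\in\Theta_1)$ and $\sigma(\theta,\cdot)>0$ $(\theta\in\Theta_2)$ are measurable, the $\epsilon_i$ are i.i.d. with mean $0$, variance $1$ and density $f>0$, and $\epsilon_i$ is independent of $\sigma(Z_j,\,j\le i)$ for each $i$. Let $G,S$ be real measurable functions and $h,h'\in\mathbb R$. Assume: $f$ is differentiable and $M_f=\dot f/f$ is twice differentiable; with $N_f(x)=1+xM_f(x)$, the functions $\ddot M_f$ and $\ddot N_f$ are bounded; for each $x$, $\rho\mapsto m(\rho,x)$ and $\theta\mapsto\sigma(\theta,x)$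 are twice differentiable on $\mathrm{int}(\Theta_1)$ and $\mathrm{int}(\Theta_2)$. Assume $\mathbb E M_f(\epsilon_0)=0$, $\mathbb E[\epsilon_0M_f(\epsilon_0)]=-1$, and $\mathbb E[\epsilon_0^j(\dot M_f(\epsilon_0)+M_f^2(\epsilon_0))]=0,0,2$ for $j=0,1,2$; and that for some $\lambda>0$ the variables $G(Z_0)/\sigma(\theta_0,Z_0)$, $S(Z_0)/\sigma(\theta_0,Z_0)$, $M_f(\epsilon_0)$, $\epsilon_0M_f(\epsilon_0)$, $\dot M_f(\epsilon_0)$, $\epsilon_0\dot M_f(\epsilon_0)$, $\epsilon_0^2M_f(\epsilon_0)$ have finite absolute moments of order $\lambda+2$, and $\mathbb E|\epsilon_0|^{2\lambda+4}<\infty$. Assume the following domination condition for $(a,k)=(2,1),(3,1),(1,1),(1,2)$. For all bounded sequences $u^{(n)}\in\mathbb R^\ell$, $v^{(n)}\in\mathbb R^p$ there are $n_0$, $\mu>0$ and, for $n\ge n_0$, closed balls $B_{1,n}\subset\mathrm{int}(\Theta_1)$ centred at $\rho_0$ of radius at least $\|n^{-1/2}u^{(n)}\|$ and $B_{2,n}\subset\mathrm{int}(\Theta_2)$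 centred at $\theta_0$ of radius at least $\|n^{-1/2}v^{(n)}\|$, and nonnegative measurable functions $N_n$ with $\mathbb E\big(\sup_{n\ge n_0}N_n(Z_0)\big)^{a+\mu}<\infty$, such that for all $x$, all $\rho\in B_{1,n}$ and all $u,\theta\in B_{2,n}$, every partial derivative of order $k$ of $m(\cdot,x)$ at $\rho$ and of $\sigma(\cdot,x)$ at $u$ is at most $N_n(x)\,\sigma(\theta,x)$ in absolute value. For parameters $(\rho,\theta)$ put $\epsilon_i(\rho,\theta)=(Y_i-m(\rho,Z_i))/\sigma(\theta,Z_i)$ and $$r_{f,h,n}(\rho,\theta)=-\frac1{\sqrt n}\sum_{i=1}^n hM_f(\epsilon_i(\rho,\theta))\frac{G(Z_i)}{\sigma(\theta,Z_i)},\qquad q_{f,h',n}(\rho,\theta)=-\frac1{\sqrt n}\sum_{i=1}^n h'N_f(\epsilon_i(\rho,\theta))\frac{S(Z_i)}{\sigma(\theta,Z_i)},$$ $\mathcal V_{n,h,h'}=r_{f,h,n}+q_{f,h',n}$. Let $K,K'\in\mathbb R^\ell$ and $J,J'\in\mathbb R^p$ have the components $$K_j=\mathbb E\Big[\frac{\partial_{\rho_j}m(\rho_0,Z_0)}{\sigma(\theta_0,Z_0)}\frac{\dot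 M_f(\epsilon_0)G(Z_0)}{\sigma(\theta_0,Z_0)}\Big],\quad K'_j=\mathbb E\Big[\frac{\partial_{\rho_j}m(\rho_0,Z_0)}{\sigma(\theta_0,Z_0)}\frac{\dot N_f(\epsilon_0)S(Z_0)}{\sigma(\theta_0,Z_0)}\Big],$$ $$J_k=\mathbb E\Big[\frac{\partial_{\theta_k}\sigma(\theta_0,Z_0)}{\sigma(\theta_0,Z_0)}\frac{\epsilon_0\dot M_f(\epsilon_0)G(Z_0)}{\sigma(\theta_0,Z_0)}\Big],\quad J'_k=\mathbb E\Big[\frac{\partial_{\theta_k}\sigma(\theta_0,Z_0)}{\sigma(\theta_0,Z_0)}\frac{\epsilon_0\dot N_f(\epsilon_0)S(Z_0)}{\sigma(\theta_0,Z_0)}\Big].$$ Let $\hat\rho_n,\hat\theta_n$ be random vectors in $\mathbb R^\ell,\mathbb R^p$ that are $\sqrt n$-consistent (for every $e>0$ there are $\eta,n_1$ with $\mathbb P(\sqrt n\|\hat\rho_n-\rho_0\|>\eta)\le e$ for all $n\ge n_1$, and likewise for $\hat\theta_n,\theta_0$) and locally discrete (for every $c>0$ the number of possible values of $\hat\rho_n$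 in $\{u:\sqrt n\|u-\rho_0\|\le c\}$ stays bounded as $n\to\infty$, and likewise for $\hat\theta_n,\theta_0$). Then the expectations defining $K,K',J,J'$ are absolutely convergent and, as $n\to\infty$, $$r_{f,h,n}(\hat\rho_n,\hat\theta_n)-r_{f,h,n}(\rho_0,\theta_0)=\sqrt n(\hat\rho_n-\rho_0)^\top hK+\sqrt n(\hat\theta_n-\theta_0)^\top hJ+o_P(1),$$ $$q_{f,h',n}(\hat\rho_n,\hat\theta_n)-q_{f,h',n}(\rho_0,\theta_0)=\sqrt n(\hat\rho_n-\rho_0)^\top h'K'+\sqrt n(\hat\theta_n-\theta_0)^\top h'J'+o_P(1),$$ $$\mathcal V_{n,h,h'}(\hat\rho_n,\hat\theta_n)-\mathcal V_{n,h,h'}(\rho_0,\theta_0)=D_{h,h'}(n)+o_P(1),$$ where $D_{h,h'}(n)=\sqrt n(\hat\rho_n-\rho_0)^\top(hK+h'K')+\sqrt n(\hat\theta_n-\theta_0)^\top(hJ+h'J')$. -/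

import Mathlib

open MeasureTheory ProbabilityTheory Filter Topology

noncomputable section

namespace ArchModel

/-- Parameter space with its Euclidean norm. -/
abbrev Par (k : ℕ) : Type := EuclideanSpace ℝ (Fin k)

/-- The space of the explanatory vectors `(Y_{i-1}, …, Y_{i-s}, X_i, …, X_{i-q})`,
where the `Y`'s are real and the `X`'s are in `ℝ^d`. -/
abbrev Reg (s q d : ℕ) : Type := (Fin s → ℝ) × (Fin (q + 1) → Fin d → ℝ)

/-- `Z_i = (Y_{i-1}, …, Y_{i-s}, X_i, X_{i-1}, …, X_{i-q})`. -/
def regressor {Ω : Type*} {d : ℕ} (s q : ℕ) (Y : ℤ → Ω → ℝ) (X : ℤ → Ω → Fin d → ℝ)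
    (i : ℤ) (ω : Ω) : Reg s q d :=
  (fun k => Y (i - 1 - ((k : ℕ) : ℤ)) ω, fun k => X (i - ((k : ℕ) : ℤ)) ω)

/-- The shift on two-sided sequences. -/
def shift {E : Type*} (w : ℤ → E) : ℤ → E := fun i => w (i + 1)

/-- The `j`-th partial derivative of `g` at `a`. -/
def partialDeriv {k : ℕ} (g : Par k → ℝ) (j : Fin k) (a : Par k) : ℝ :=
  fderiv ℝ g a (EuclideanSpace.single j 1)

/-- The second partial derivative of `g` at `a` in the directions `i` and `j`. -/
def partialDeriv₂ {k : ℕ} (g : Par k → ℝ) (i j : Fin k) (a : Par k) : ℝ :=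
  partialDeriv (partialDeriv g j) i a

/-- `M_f = f' / f`. -/
def score (f : ℝ → ℝ) (x : ℝ) : ℝ := deriv f x / f x

/-- `N_f(x) = 1 + x M_f(x)`. -/
def scaleScore (f : ℝ → ℝ) (x : ℝ) : ℝ := 1 + x * score f x

/-- The deterministic ingredients: parameter sets, the conditional mean and scale functions,
the two directions of the local alternative, the density of the noise, the true parameter. -/
structure Spec (s q d ℓ p : ℕ) where
  Θ₁ : Set (Par ℓ)
  Θ₂ : Set (Par p)
  m : Par ℓ → Reg s q d → ℝ
  σ : Par p → Reg s q d → ℝ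
  G : Reg s q d → ℝ
  S : Reg s q d → ℝ
  f : ℝ → ℝ
  ρ₀ : Par ℓ
  θ₀ : Par p

variable {s q d ℓ p : ℕ} {Ω : Type*}

/-- Standing regularity of the ingredients: measurability, positivity of the scale and of the
density, two derivatives of `m` and `σ` in the parameter, two derivatives of `M_f` with `M_f''`
and `N_f''` bounded. -/
structure Spec.Regular (M : Spec s q d ℓ p) : Prop where
  meas_m : ∀ ρ ∈ M.Θ₁, Measurable (M.m ρ)
  meas_σ : ∀ θ ∈ M.Θ₂, Measurable (M.σ θ)
  meas_G : Measurable M.G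
  meas_S : Measurable M.S
  σ_pos : ∀ θ ∈ M.Θ₂, ∀ z, 0 < M.σ θ z
  diff_m : ∀ z, DifferentiableOn ℝ (fun ρ => M.m ρ z) (interior M.Θ₁)
  diff₂_m : ∀ z, DifferentiableOn ℝ (fderiv ℝ (fun ρ => M.m ρ z)) (interior M.Θ₁)
  diff_σ : ∀ z, DifferentiableOn ℝ (fun θ => M.σ θ z) (interior M.Θ₂)
  diff₂_σ : ∀ z, DifferentiableOn ℝ (fderiv ℝ (fun θ => M.σ θ z)) (interior M.Θ₂)
  f_pos : ∀ x, 0 < M.f x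
  diff_f : Differentiable ℝ M.f
  diff_score : Differentiable ℝ (score M.f)
  diff₂_score : Differentiable ℝ (deriv (score M.f))
  bdd_score : ∃ C : ℝ, ∀ x, |deriv (deriv (score M.f)) x| ≤ C
  bdd_scaleScore : ∃ C : ℝ, ∀ x, |deriv (deriv (scaleScore M.f)) x| ≤ C

/-- The model under the null hypothesis: `(Y_i, X_i)` is stationary and ergodic with finite
second and third moments, `Y_i = m(ρ₀, Z_i) + σ(θ₀, Z_i) ε_i`, the `ε_i` are i.i.d. with density
`f`, mean `0` and variance `1`, and `ε_i` is independent of the `σ`-field of `(Z_j, j ≤ i)`. -/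
structure Spec.Null [MeasurableSpace Ω] (M : Spec s q d ℓ p) (P : Measure Ω)
    (Y : ℤ → Ω → ℝ) (X : ℤ → Ω → Fin d → ℝ) (ε : ℤ → Ω → ℝ) : Prop where
  ρ₀_mem : M.ρ₀ ∈ M.Θ₁
  θ₀_mem : M.θ₀ ∈ M.Θ₂
  meas_Y : ∀ i, Measurable (Y i)
  meas_X : ∀ i, Measurable (X i)
  meas_ε : ∀ i, Measurable (ε i)
  /-- The shift preserves the law of the path `(Y_i, X_i)_{i ∈ ℤ}` and is ergodic for it. -/
  ergodic : Ergodic (shift (E := ℝ × (Fin d → ℝ)))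
    (P.map (fun ω (i : ℤ) => (Y i ω, X i ω)))
  moment_Y : MemLp (Y 0) 3 P
  moment_X : MemLp (X 0) 3 P
  model : ∀ i, ∀ᵐ ω ∂P, Y i ω =
    M.m M.ρ₀ (regressor s q Y X i ω) + M.σ M.θ₀ (regressor s q Y X i ω) * ε i ω
  iindep : iIndepFun ε P
  density : ∀ i, P.map (ε i) = volume.withDensity (fun x => ENNReal.ofReal (M.f x))
  centred : ∫ ω, ε 0 ω ∂P = 0
  unit_variance : ∫ ω, ε 0 ω ^ 2 ∂P = 1
  indep_past : ∀ i : ℤ, Indep (MeasurableSpace.comap (ε i) inferInstance)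
    (⨆ j : {j : ℤ // j ≤ i}, MeasurableSpace.comap (regressor s q Y X j.1) inferInstance) P

/-- Moment identities of the score. -/
structure Spec.ScoreIdentities [MeasurableSpace Ω] (M : Spec s q d ℓ p) (P : Measure Ω)
    (ε : ℤ → Ω → ℝ) : Prop where
  one : ∫ ω, score M.f (ε 0 ω) ∂P = 0
  two : ∫ ω, ε 0 ω * score M.f (ε 0 ω) ∂P = -1
  three : ∫ ω, (deriv (score M.f) (ε 0 ω) + score M.f (ε 0 ω) ^ 2) ∂P = 0
  four : ∫ ω, ε 0 ω * (deriv (score M.f) (ε 0 ω) + score M.f (ε 0 ω) ^ 2) ∂P = 0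
  five : ∫ ω, ε 0 ω ^ 2 * (deriv (score M.f) (ε 0 ω) + score M.f (ε 0 ω) ^ 2) ∂P = 2

/-- `E |U|^a < ∞`. -/
def HasMoment [MeasurableSpace Ω] (P : Measure Ω) (U : Ω → ℝ) (a : ℝ) : Prop :=
  Integrable (fun ω => |U ω| ^ a) P

/-- Moment conditions, with a common `lam > 0`. -/
def Spec.Moments [MeasurableSpace Ω] (M : Spec s q d ℓ p) (P : Measure Ω)
    (Y : ℤ → Ω → ℝ) (X : ℤ → Ω → Fin d → ℝ) (ε : ℤ → Ω → ℝ) : Prop :=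
  ∃ lam : ℝ, 0 < lam ∧
    HasMoment P (fun ω => M.G (regressor s q Y X 0 ω) / M.σ M.θ₀ (regressor s q Y X 0 ω))
      (lam + 2) ∧
    HasMoment P (fun ω => M.S (regressor s q Y X 0 ω) / M.σ M.θ₀ (regressor s q Y X 0 ω))
      (lam + 2) ∧
    HasMoment P (fun ω => score M.f (ε 0 ω)) (lam + 2) ∧
    HasMoment P (fun ω => ε 0 ω * score M.f (ε 0 ω)) (lam + 2) ∧
    HasMoment P (fun ω => deriv (score M.f) (ε 0 ω)) (lam + 2) ∧
    HasMoment P (fun ω => ε 0 ω * deriv (score M.f) (ε 0 ω)) (lam + 2) ∧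
    HasMoment P (ε 0) (2 * lam + 4) ∧
    HasMoment P (fun ω => ε 0 ω ^ 2 * score M.f (ε 0 ω)) (lam + 2)

/-- `N` bounds, at the point `z`, the first partial derivatives of `m` and `σ` relative to `σ`, for
parameters in the balls `B₁` and `B₂`. -/
def Spec.Bound₁ (M : Spec s q d ℓ p) (B₁ : Set (Par ℓ)) (B₂ : Set (Par p)) (z : Reg s q d)
    (N : ℝ) : Prop :=
  (∀ ρ ∈ B₁, ∀ θ ∈ B₂, ∀ i, |partialDeriv (fun r => M.m r z) i ρ| / M.σ θ z ≤ N) ∧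
  (∀ u ∈ B₂, ∀ θ ∈ B₂, ∀ j, |partialDeriv (fun t => M.σ t z) j u| / M.σ θ z ≤ N)

/-- The same for the second partial derivatives. -/
def Spec.Bound₂ (M : Spec s q d ℓ p) (B₁ : Set (Par ℓ)) (B₂ : Set (Par p)) (z : Reg s q d)
    (N : ℝ) : Prop :=
  (∀ ρ ∈ B₁, ∀ θ ∈ B₂, ∀ i j, |partialDeriv₂ (fun r => M.m r z) i j ρ| / M.σ θ z ≤ N) ∧
  (∀ u ∈ B₂, ∀ θ ∈ B₂, ∀ k l, |partialDeriv₂ (fun t => M.σ t z) k l u| / M.σ θ z ≤ N)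

/-- The domination condition with moment exponent `a + μ`, `μ > 0`: for all bounded local sequences
`ρ_n = ρ₀ + n^{-1/2} u_n`, `θ_n = θ₀ + n^{-1/2} v_n` there are, for `n ≥ n₀`, closed balls around
`ρ₀` and `θ₀`, inside the interiors of the parameter sets, that contain `ρ_n` and `θ_n`, and
nonnegative functions `N_n` that bound the derivatives on these balls, with
`E (sup_n N_n(Z₀))^{a + μ} < ∞`. -/
def Spec.Dominated [MeasurableSpace Ω] (M : Spec s q d ℓ p) (P : Measure Ω)
    (Y : ℤ → Ω → ℝ) (X : ℤ → Ω → Fin d → ℝ) (a : ℝ)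
    (Bound : Set (Par ℓ) → Set (Par p) → Reg s q d → ℝ → Prop) : Prop :=
  ∀ (u : ℕ → Par ℓ) (v : ℕ → Par p), (∃ C : ℝ, ∀ n, ‖u n‖ ^ 2 + ‖v n‖ ^ 2 ≤ C) →
    ∃ (n₀ : ℕ) (r₁ r₂ : ℕ → ℝ) (N : ℕ → Reg s q d → ℝ) (μ : ℝ), 0 < μ ∧
      (∀ n, n₀ ≤ n →
        ‖(√(n : ℝ))⁻¹ • u n‖ ≤ r₁ n ∧ ‖(√(n : ℝ))⁻¹ • v n‖ ≤ r₂ n ∧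
        Metric.closedBall M.ρ₀ (r₁ n) ⊆ interior M.Θ₁ ∧
        Metric.closedBall M.θ₀ (r₂ n) ⊆ interior M.Θ₂ ∧
        Measurable (N n) ∧ (∀ z, 0 ≤ N n z) ∧
        ∀ z, Bound (Metric.closedBall M.ρ₀ (r₁ n)) (Metric.closedBall M.θ₀ (r₂ n)) z (N n z)) ∧
      ∫⁻ ω, (⨆ n : {n : ℕ // n₀ ≤ n},
        ENNReal.ofReal (N n.1 (regressor s q Y X 0 ω))) ^ (a + μ) ∂P < ⊤

/-- The four domination conditions. -/
structure Spec.Domination [MeasurableSpace Ω] (M : Spec s q d ℓ p) (P : Measure Ω)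
    (Y : ℤ → Ω → ℝ) (X : ℤ → Ω → Fin d → ℝ) : Prop where
  one : M.Dominated P Y X 2 M.Bound₁
  two : M.Dominated P Y X 3 M.Bound₁
  three : M.Dominated P Y X 1 M.Bound₁
  four : M.Dominated P Y X 1 M.Bound₂

/-- The residual `(Y_i - m(ρ, Z_i)) / σ(θ, Z_i)`. -/
def Spec.residual (M : Spec s q d ℓ p) (Y : ℤ → Ω → ℝ) (X : ℤ → Ω → Fin d → ℝ)
    (ρ : Par ℓ) (θ : Par p) (i : ℤ) (ω : Ω) : ℝ :=
  (Y i ω - M.m ρ (regressor s q Y X i ω)) / M.σ θ (regressor s q Y X i ω)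

/-- `r_{f,h,n}(ρ, θ)`. -/
def Spec.rStat (M : Spec s q d ℓ p) (Y : ℤ → Ω → ℝ) (X : ℤ → Ω → Fin d → ℝ)
    (h : ℝ) (n : ℕ) (ρ : Par ℓ) (θ : Par p) (ω : Ω) : ℝ :=
  -(√(n : ℝ))⁻¹ * ∑ i ∈ Finset.Icc 1 n, h * score M.f (M.residual Y X ρ θ (i : ℤ) ω) *
    (M.G (regressor s q Y X (i : ℤ) ω) / M.σ θ (regressor s q Y X (i : ℤ) ω))

/-- `q_{f,h',n}(ρ, θ)`. -/
def Spec.qStat (M : Spec s q d ℓ p) (Y : ℤ → Ω → ℝ) (X : ℤ → Ω → Fin d → ℝ)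
    (h' : ℝ) (n : ℕ) (ρ : Par ℓ) (θ : Par p) (ω : Ω) : ℝ :=
  -(√(n : ℝ))⁻¹ * ∑ i ∈ Finset.Icc 1 n,
    h' * (1 + M.residual Y X ρ θ (i : ℤ) ω * score M.f (M.residual Y X ρ θ (i : ℤ) ω)) *
      (M.S (regressor s q Y X (i : ℤ) ω) / M.σ θ (regressor s q Y X (i : ℤ) ω))

/-- The central sequence `V_{n,h,h'}(ρ, θ)`. -/
def Spec.central (M : Spec s q d ℓ p) (Y : ℤ → Ω → ℝ) (X : ℤ → Ω → Fin d → ℝ)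
    (h h' : ℝ) (n : ℕ) (ρ : Par ℓ) (θ : Par p) (ω : Ω) : ℝ :=
  M.rStat Y X h n ρ θ ω + M.qStat Y X h' n ρ θ ω

/-- `(∂m(ρ₀,Z₀)/∂ρ_j / σ(θ₀,Z₀)) · g(ε₀) H(Z₀) / σ(θ₀,Z₀)`. -/
def Spec.meanTerm (M : Spec s q d ℓ p) (Y : ℤ → Ω → ℝ) (X : ℤ → Ω → Fin d → ℝ)
    (ε : ℤ → Ω → ℝ) (g : ℝ → ℝ) (H : Reg s q d → ℝ) (j : Fin ℓ) (ω : Ω) : ℝ :=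
  partialDeriv (fun r => M.m r (regressor s q Y X 0 ω)) j M.ρ₀ /
      M.σ M.θ₀ (regressor s q Y X 0 ω) *
    (g (ε 0 ω) * H (regressor s q Y X 0 ω) / M.σ M.θ₀ (regressor s q Y X 0 ω))

/-- `(∂σ(θ₀,Z₀)/∂θ_k / σ(θ₀,Z₀)) · ε₀ g(ε₀) H(Z₀) / σ(θ₀,Z₀)`. -/
def Spec.scaleTerm (M : Spec s q d ℓ p) (Y : ℤ → Ω → ℝ) (X : ℤ → Ω → Fin d → ℝ)
    (ε : ℤ → Ω → ℝ) (g : ℝ → ℝ) (H : Reg s q d → ℝ) (k : Fin p) (ω : Ω) : ℝ :=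
  partialDeriv (fun t => M.σ t (regressor s q Y X 0 ω)) k M.θ₀ /
      M.σ M.θ₀ (regressor s q Y X 0 ω) *
    (ε 0 ω * g (ε 0 ω) * H (regressor s q Y X 0 ω) / M.σ M.θ₀ (regressor s q Y X 0 ω))

section Constants

variable [MeasurableSpace Ω]

/-- The constant `K_j`. -/
def Spec.K (M : Spec s q d ℓ p) (P : Measure Ω) (Y : ℤ → Ω → ℝ) (X : ℤ → Ω → Fin d → ℝ)
    (ε : ℤ → Ω → ℝ) (j : Fin ℓ) : ℝ :=
  ∫ ω, M.meanTerm Y X ε (deriv (score M.f)) M.G j ω ∂P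

/-- The constant `K'_j`. -/
def Spec.K' (M : Spec s q d ℓ p) (P : Measure Ω) (Y : ℤ → Ω → ℝ) (X : ℤ → Ω → Fin d → ℝ)
    (ε : ℤ → Ω → ℝ) (j : Fin ℓ) : ℝ :=
  ∫ ω, M.meanTerm Y X ε (deriv (scaleScore M.f)) M.S j ω ∂P

/-- The constant `J_k`. -/
def Spec.J (M : Spec s q d ℓ p) (P : Measure Ω) (Y : ℤ → Ω → ℝ) (X : ℤ → Ω → Fin d → ℝ)
    (ε : ℤ → Ω → ℝ) (k : Fin p) : ℝ :=
  ∫ ω, M.scaleTerm Y X ε (deriv (score M.f)) M.G k ω ∂P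

/-- The constant `J'_k`. -/
def Spec.J' (M : Spec s q d ℓ p) (P : Measure Ω) (Y : ℤ → Ω → ℝ) (X : ℤ → Ω → Fin d → ℝ)
    (ε : ℤ → Ω → ℝ) (k : Fin p) : ℝ :=
  ∫ ω, M.scaleTerm Y X ε (deriv (scaleScore M.f)) M.S k ω ∂P

/-- Root-`n` consistency of `est` for `a`. -/
def RootNConsistent {k : ℕ} (P : Measure Ω) (est : ℕ → Ω → Par k) (a : Par k) : Prop :=
  ∀ e : ℝ, 0 < e → ∃ (η : ℝ) (n₁ : ℕ), ∀ n, n₁ ≤ n →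
    P {ω | η < √(n : ℝ) * ‖est n ω - a‖} ≤ ENNReal.ofReal e

end Constants

/-- Local discreteness: for each `c > 0`, the number of possible values of `est n` in the ball of
radius `c / √n` around `a` stays bounded as `n → ∞`. -/
def LocallyDiscrete {k : ℕ} (est : ℕ → Ω → Par k) (a : Par k) : Prop :=
  ∀ c : ℝ, 0 < c → ∃ (B n₁ : ℕ), ∀ n, n₁ ≤ n →
    (Set.range (est n) ∩ {u | √(n : ℝ) * ‖u - a‖ ≤ c}).encard ≤ B

/-- The linear form `√n (est - a)ᵀ c`. -/
def linForm {k : ℕ} (n : ℕ) (est a : Par k) (c : Fin k → ℝ) : ℝ :=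
  ∑ j, √(n : ℝ) * (est j - a j) * c j

/-- `D_{h,h'}(n) = √n (ρ̂_n - ρ₀)ᵀ (h K + h' K') + √n (θ̂_n - θ₀)ᵀ (h J + h' J')`. -/
def Spec.D [MeasurableSpace Ω] (M : Spec s q d ℓ p) (P : Measure Ω) (Y : ℤ → Ω → ℝ)
    (X : ℤ → Ω → Fin d → ℝ) (ε : ℤ → Ω → ℝ) (h h' : ℝ) (ρhat : ℕ → Ω → Par ℓ)
    (θhat : ℕ → Ω → Par p) (n : ℕ) (ω : Ω) : ℝ :=
  linForm n (ρhat n ω) M.ρ₀ (fun j => h * M.K P Y X ε j + h' * M.K' P Y X ε j) +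
  linForm n (θhat n ω) M.θ₀ (fun k => h * M.J P Y X ε k + h' * M.J' P Y X ε k)

end ArchModel

end

/-! Both statistics have the form `Spec.stat`: a normalised sum of `g(ε_i(ρ,θ)) H(Z_i) / σ(θ,Z_i)`,
where `g` has bounded second derivative and `g(ε₀)` is centred. So one expansion, applied to `(M_f,
G)` and to `(N_f, S)`, gives the two claims, and their sum gives the third.

Local discreteness reduces the estimators to deterministic sequences `ρ₀ + u_n/√n`, `θ₀ + v_n/√n`
with `u_n`, `v_n` bounded (`tendstoInMeasure_of_locallyDiscrete`): near the truth the estimators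
take boundedly many values, and convergence along all bounded sequences is uniform on bounded sets.

Along such a sequence the process is moved to the space of paths with its ergodic shift. The
increment of the statistic is then `-h` times an orbit average of `√n` times the increment of one
summand. This function splits into a linear part in `(u_n, v_n)`, given by the derivative at the
truth, and a remainder. For the linear part the mean ergodic theorem
(`Ergodic.tendstoInMeasure_orbitAverage`) gives the constants; the derivative of the weight `H/σ`
leaves a term with factor `g(ε₀)`, of mean zero by independence (`integral_noiseTerm`).

The remainder tends to zero pointwise by differentiability. With `N` the square integrable envelope
of the relative derivatives, `abs_summand_sub_le` gives an integrable bound on `{N ≤ √n}`, so the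
truncated remainder tends to zero in `L¹`, and by stationarity so do its averages. The truncation
fails at one of the `n` times with probability at most `n P(N > √n)`, which tends to zero
(`MeasurePreserving.tendstoInMeasure_orbitAverage_zero`). -/

open MeasureTheory ProbabilityTheory Filter Topology

/-! ### Orbit averages. -/

/-- The average of `f` over the first `n` iterates of `T`, the starting point excluded. -/
noncomputable def orbitAverage {α : Type*} (T : α → α) (f : α → ℝ) (n : ℕ) (x : α) : ℝ :=
  (n : ℝ)⁻¹ * ∑ i ∈ Finset.Icc 1 n, f (T^[i] x)

theorem orbitAverage_add {α : Type*} (T : α → α) (f g : α → ℝ) (n : ℕ) (x : α) :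
    orbitAverage T (fun y => f y + g y) n x = orbitAverage T f n x + orbitAverage T g n x := by
  simp [orbitAverage, Finset.sum_add_distrib, mul_add]

theorem orbitAverage_const_mul {α : Type*} (T : α → α) (c : ℝ) (f : α → ℝ) (n : ℕ) (x : α) :
    orbitAverage T (fun y => c * f y) n x = c * orbitAverage T f n x := by
  simp only [orbitAverage, ← Finset.mul_sum]
  ring

theorem orbitAverage_sum {ι α : Type*} (s : Finset ι) (T : α → α) (f : ι → α → ℝ) (n : ℕ)
    (x : α) :
    orbitAverage T (fun y => ∑ j ∈ s, f j y) n x = ∑ j ∈ s, orbitAverage T (f j) n x := by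
  simp only [orbitAverage, ← Finset.mul_sum]
  rw [Finset.sum_comm]

/-! ### Convergence in measure to zero. -/

section InMeasure

variable {α : Type*} [MeasurableSpace α] {μ : Measure α} {f g : ℕ → α → ℝ}

theorem tendstoInMeasure_zero_iff :
    TendstoInMeasure μ f atTop (fun _ => 0) ↔
      ∀ ε : ℝ, 0 < ε → Tendsto (fun n => μ {x | ε ≤ |f n x|}) atTop (𝓝 0) := by
  rw [tendstoInMeasure_iff_norm]
  simp [Real.norm_eq_abs]

theorem MeasureTheory.TendstoInMeasure.zero_of_abs_le_mul
    (hf : TendstoInMeasure μ f atTop (fun _ => 0))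
    {C : ℝ} (h : ∀ᶠ n in atTop, ∀ x, |g n x| ≤ C * |f n x|) :
    TendstoInMeasure μ g atTop (fun _ => 0) := by
  rw [tendstoInMeasure_zero_iff] at hf ⊢
  intro ε hε
  -- `C` may be zero or negative, so the threshold is divided by `|C| + 1`.
  have hC : 0 < |C| + 1 := by positivity
  refine tendsto_of_tendsto_of_tendsto_of_le_of_le' tendsto_const_nhds (hf (ε / (|C| + 1))
    (by positivity)) (by simp) ?_
  filter_upwards [h] with n hn
  refine measure_mono fun x hx => ?_
  simp only [Set.mem_ofPred_eq] at hx ⊢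
  rw [div_le_iff₀ hC]
  have h1 := hn x
  have h2 : C * |f n x| ≤ |C| * |f n x| := by gcongr; exact le_abs_self C
  nlinarith [abs_nonneg (f n x)]

theorem MeasureTheory.TendstoInMeasure.zero_add (hf : TendstoInMeasure μ f atTop (fun _ => 0))
    (hg : TendstoInMeasure μ g atTop (fun _ => 0)) :
    TendstoInMeasure μ (fun n x => f n x + g n x) atTop (fun _ => 0) := by
  rw [tendstoInMeasure_zero_iff] at hf hg ⊢
  intro ε hε
  have := (hf (ε / 2) (by positivity)).add (hg (ε / 2) (by positivity))
  rw [add_zero] at this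
  refine tendsto_of_tendsto_of_tendsto_of_le_of_le tendsto_const_nhds this (fun _ => zero_le)
    fun n => (measure_mono fun x hx => ?_).trans (measure_union_le _ _)
  simp only [Set.mem_ofPred_eq, Set.mem_union] at hx ⊢
  by_contra! hcon
  linarith [abs_add_le (f n x) (g n x)]

theorem MeasureTheory.TendstoInMeasure.zero_sum {ι : Type*} (s : Finset ι) {F : ι → ℕ → α → ℝ}
    (hF : ∀ j ∈ s, TendstoInMeasure μ (F j) atTop (fun _ => 0)) :
    TendstoInMeasure μ (fun n x => ∑ j ∈ s, F j n x) atTop (fun _ => 0) := by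
  classical
  induction s using Finset.induction_on with
  | empty =>
    rw [tendstoInMeasure_zero_iff]
    intro ε hε
    simp [hε.not_ge]
  | insert a s ha ih =>
    simp only [Finset.sum_insert ha]
    exact (hF a (by simp)).zero_add (ih fun j hj => hF j (by simp [hj]))

/-- Pulling back along a random variable preserves convergence in measure to zero. -/
theorem MeasureTheory.TendstoInMeasure.zero_of_map {β : Type*} [MeasurableSpace β]
    {φ : β → α} {ν : Measure β}
    (hφ : AEMeasurable φ ν) (hf : TendstoInMeasure (ν.map φ) f atTop (fun _ => 0)) :
    TendstoInMeasure ν (fun n x => f n (φ x)) atTop (fun _ => 0) := by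
  rw [tendstoInMeasure_zero_iff] at hf ⊢
  intro ε hε
  -- Only `ν (φ⁻¹ A) ≤ (ν.map φ) A` is needed. It holds for every set `A`, so `f n` need not be
  -- measurable.
  exact tendsto_of_tendsto_of_tendsto_of_le_of_le tendsto_const_nhds (hf ε hε)
    (fun _ => zero_le) fun n => Measure.le_map_apply hφ {x | ε ≤ |f n x|}

/-- Markov's inequality. -/
theorem tendstoInMeasure_zero_of_integral_abs (hf : ∀ᶠ n in atTop, Integrable (f n) μ)
    (h : Tendsto (fun n => ∫ x, |f n x| ∂μ) atTop (𝓝 0)) :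
    TendstoInMeasure μ f atTop (fun _ => 0) := by
  rw [tendstoInMeasure_zero_iff]
  intro ε hε
  have h1 : Tendsto (fun n => ENNReal.ofReal (∫ x, |f n x| ∂μ) / ENNReal.ofReal ε)
      atTop (𝓝 0) := by
    have := ENNReal.Tendsto.div_const (b := ENNReal.ofReal ε)
      (ENNReal.tendsto_ofReal h) (Or.inr (by simpa using hε))
    simpa using this
  refine tendsto_of_tendsto_of_tendsto_of_le_of_le' tendsto_const_nhds h1 (by simp) ?_
  filter_upwards [hf] with n hn
  rw [ofReal_integral_eq_lintegral_ofReal hn.abs (by filter_upwards with x using abs_nonneg _)]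
  have := meas_ge_le_lintegral_div (μ := μ) (f := fun x => ENNReal.ofReal |f n x|)
    hn.abs.aestronglyMeasurable.aemeasurable.ennreal_ofReal (ε := ENNReal.ofReal ε)
    (by simpa using hε) (by simp)
  refine le_trans (measure_mono fun x hx => ?_) this
  exact ENNReal.ofReal_le_ofReal hx

end InMeasure

/-! ### Mean ergodic theorem and truncated averages. -/

section Ergodic

variable {α : Type*} [MeasurableSpace α] {μ : Measure α} {T : α → α}

theorem MeasureTheory.MeasurePreserving.integrable_orbitAverage (hT : MeasurePreserving T μ μ)
    {f : α → ℝ} (hf : Integrable f μ) (n : ℕ) : Integrable (orbitAverage T f n) μ :=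
  (integrable_finsetSum _ fun i _ =>
    ((hT.iterate i).integrable_comp hf.aestronglyMeasurable).2 hf).const_mul _

/-- By invariance all summands have the same `L¹` norm, so averaging is an `L¹` contraction. -/
theorem MeasureTheory.MeasurePreserving.integral_abs_orbitAverage_le
    (hT : MeasurePreserving T μ μ) {f : α → ℝ} (hf : Integrable f μ) (n : ℕ) :
    ∫ x, |orbitAverage T f n x| ∂μ ≤ ∫ x, |f x| ∂μ := by
  have hi : ∀ i, Integrable (fun x => |f (T^[i] x)|) μ := fun i =>
    (((hT.iterate i).integrable_comp hf.aestronglyMeasurable).2 hf).abs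
  have hint : ∀ i, ∫ x, |f (T^[i] x)| ∂μ = ∫ x, |f x| ∂μ := fun i => by
    conv_rhs => rw [← (hT.iterate i).map_eq]
    rw [integral_map (hT.iterate i).measurable.aemeasurable]
    rw [(hT.iterate i).map_eq]
    exact hf.abs.aestronglyMeasurable
  calc ∫ x, |orbitAverage T f n x| ∂μ
      ≤ ∫ x, (n : ℝ)⁻¹ * ∑ i ∈ Finset.Icc 1 n, |f (T^[i] x)| ∂μ := by
        refine integral_mono (hT.integrable_orbitAverage hf n).abs
          ((integrable_finsetSum _ fun i _ => hi i).const_mul _) fun x => ?_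
        simp only [orbitAverage, abs_mul, abs_inv, Nat.abs_cast]
        gcongr
        exact Finset.abs_sum_le_sum_abs _ _
    _ = (n : ℝ)⁻¹ * (n * ∫ x, |f x| ∂μ) := by
        rw [integral_const_mul, integral_finsetSum _ fun i _ => hi i]
        simp [hint]
    _ ≤ ∫ x, |f x| ∂μ := by
        rcases Nat.eq_zero_or_pos n with rfl | hn
        · simpa using integral_nonneg fun x => abs_nonneg (f x)
        · rw [inv_mul_cancel_left₀ (by positivity)]

/-- Mean ergodic theorem in `L²`. -/
theorem Ergodic.tendsto_integral_abs_orbitAverage_of_memLp_two [IsProbabilityMeasure μ]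
    (hT : Ergodic T μ) {f : α → ℝ} (hf : MemLp f 2 μ) :
    Tendsto (fun n => ∫ x, |orbitAverage T f n x - ∫ y, f y ∂μ| ∂μ) atTop (𝓝 0) := by
  have hTm := hT.toMeasurePreserving
  set U : Lp ℝ 2 μ →L[ℝ] Lp ℝ 2 μ :=
    (Lp.compMeasurePreservingₗᵢ ℝ T hTm).toContinuousLinearMap with hU
  -- Birkhoff averages start at the zeroth iterate and `orbitAverage` at the first; starting from `f
  -- ∘ T` aligns the indices.
  have hfT : MemLp (f ∘ T) 2 μ := hf.comp_measurePreserving hTm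
  set F : Lp ℝ 2 μ := hfT.toLp with hF
  -- Von Neumann's theorem: the averages converge in `L²` to the projection on the fixed vectors of
  -- the Koopman operator.
  obtain ⟨Q, hQfix, hQ⟩ : ∃ Q : Lp ℝ 2 μ, U Q = Q ∧
      Tendsto (birkhoffAverage ℝ U _root_.id · F) atTop (𝓝 Q) :=
    ⟨_, ((U.eqLocus (1 : Lp ℝ 2 μ →L[ℝ] Lp ℝ 2 μ)).orthogonalProjectionOnto F).2,
      U.tendsto_birkhoffAverage_orthogonalProjection
      (LinearIsometry.norm_toContinuousLinearMap_le _) F⟩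
  have hiter : ∀ i, (U^[i] F : α → ℝ) =ᵐ[μ] fun x => f (T^[i + 1] x) := by
    intro i
    induction i with
    | zero => exact hfT.coeFn_toLp
    | succ i ih =>
      rw [Function.iterate_succ_apply']
      refine (Lp.coeFn_compMeasurePreserving (U^[i] F) hTm).trans ?_
      refine (hTm.quasiMeasurePreserving.ae_eq_comp ih).trans ?_
      filter_upwards with x
      simp only [Function.comp_apply]
      rw [← Function.iterate_succ_apply]
  have havg : ∀ n, ⇑(birkhoffAverage ℝ U _root_.id n F : Lp ℝ 2 μ) =ᵐ[μ] orbitAverage T f n := by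
    intro n
    have h1 : ∀ᵐ x ∂μ, ∀ i, (U^[i] F : α → ℝ) x = f (T^[i + 1] x) := ae_all_iff.2 hiter
    have h2 := Lp.coeFn_smul (n : ℝ)⁻¹ (∑ i ∈ Finset.range n, U^[i] F)
    have h3 := Lp.coeFn_finsetSum (Finset.range n) (fun i => U^[i] F)
    filter_upwards [h1, h2, h3] with x h1 h2 h3
    simp only [birkhoffAverage, birkhoffSum, _root_.id]
    rw [h2, Pi.smul_apply, h3]
    simp only [orbitAverage, smul_eq_mul, Finset.sum_apply, h1]
    congr 1
    rw [Finset.range_eq_Ico, Finset.sum_Ico_add' (fun i => f (T^[i] x)) 0 n 1]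
    rfl
  -- Ergodicity makes the fixed vector constant; since averaging preserves the mean, the constant is
  -- later found to be `∫ f`.
  obtain ⟨c, hc⟩ : ∃ c, (Q : α → ℝ) =ᵐ[μ] Function.const α c := by
    refine hT.ae_eq_const_of_ae_eq_comp_ae (Lp.aestronglyMeasurable Q) ?_
    refine (Lp.coeFn_compMeasurePreserving Q hTm).symm.trans ?_
    rw [show Lp.compMeasurePreserving T hTm Q = U Q from rfl, hQfix]
  have hfi : Integrable f μ := hf.integrable (by norm_num)
  have hint : ∀ n, Integrable (fun x => orbitAverage T f n x - c) μ := fun n =>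
    (hTm.integrable_orbitAverage hfi n).sub (integrable_const c)
  have hlim : Tendsto (fun n => ∫ x, |orbitAverage T f n x - c| ∂μ) atTop (𝓝 0) := by
    have h0 : Tendsto (fun n => ‖birkhoffAverage ℝ U _root_.id n F - Q‖) atTop (𝓝 0) :=
      tendsto_iff_norm_sub_tendsto_zero.1 hQ
    refine squeeze_zero (fun n => integral_nonneg fun x => abs_nonneg _) (fun n => ?_) h0
    have hae : (birkhoffAverage ℝ U _root_.id n F - Q : Lp ℝ 2 μ) =ᵐ[μ]
        fun x => orbitAverage T f n x - c := by
      filter_upwards [Lp.coeFn_sub (birkhoffAverage ℝ U _root_.id n F) Q, havg n, hc]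
        with x h1 h2 h3
      rw [h1, Pi.sub_apply, h2, h3]; rfl
    have hmem : MemLp (fun x => orbitAverage T f n x - c) 2 μ := (memLp_congr_ae hae).1 (Lp.memLp _)
    rw [Lp.norm_def, eLpNorm_congr_ae hae]
    have : ∫ x, |orbitAverage T f n x - c| ∂μ
        = (eLpNorm (fun x => orbitAverage T f n x - c) 1 μ).toReal := by
      rw [eLpNorm_one_eq_lintegral_enorm, ← integral_norm_eq_lintegral_enorm
        (hint n).aestronglyMeasurable]
      rfl
    rw [this]
    exact ENNReal.toReal_mono hmem.2.ne
      (eLpNorm_le_eLpNorm_of_exponent_le (by norm_num) (hint n).aestronglyMeasurable)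
  have hmean : ∀ n : ℕ, 1 ≤ n → ∫ x, orbitAverage T f n x ∂μ = ∫ x, f x ∂μ := by
    intro n hn
    simp only [orbitAverage]
    have hi : ∀ i, Integrable (fun x => f (T^[i] x)) μ := fun i =>
      ((hTm.iterate i).integrable_comp hfi.aestronglyMeasurable).2 hfi
    rw [integral_const_mul, integral_finsetSum _ fun i _ => hi i]
    have : ∀ i, ∫ x, f (T^[i] x) ∂μ = ∫ x, f x ∂μ := fun i => by
      conv_rhs => rw [← (hTm.iterate i).map_eq]
      rw [integral_map (hTm.iterate i).measurable.aemeasurable]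
      rw [(hTm.iterate i).map_eq]
      exact hfi.aestronglyMeasurable
    simp only [this, Finset.sum_const, Nat.card_Icc, Nat.add_sub_cancel, nsmul_eq_mul]
    rw [inv_mul_cancel_left₀ (by positivity)]
  have hcf : c = ∫ x, f x ∂μ := by
    have h1 : Tendsto (fun n : ℕ => |∫ x, f x ∂μ - c|) atTop (𝓝 0) := by
      refine squeeze_zero' (by simp) ?_ hlim
      filter_upwards [eventually_ge_atTop 1] with n hn
      rw [← hmean n hn]
      have : ∫ x, orbitAverage T f n x ∂μ - c = ∫ x, (orbitAverage T f n x - c) ∂μ := by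
        rw [integral_sub (hTm.integrable_orbitAverage hfi n) (integrable_const c)]; simp
      rw [this]
      exact abs_integral_le_integral_abs
    have := tendsto_nhds_unique h1 tendsto_const_nhds
    linarith [abs_eq_zero.1 this.symm]
  rwa [← hcf]

/-- Mean ergodic theorem in `L¹`. -/
theorem Ergodic.tendsto_integral_abs_orbitAverage [IsProbabilityMeasure μ]
    (hT : Ergodic T μ) {f : α → ℝ} (hf : Integrable f μ) :
    Tendsto (fun n => ∫ x, |orbitAverage T f n x - ∫ y, f y ∂μ| ∂μ) atTop (𝓝 0) := by
  have hTm := hT.toMeasurePreserving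
  rw [Metric.tendsto_atTop]
  intro ε hε
  -- Simple functions are dense in `L¹` and lie in `L²`. Three errors below `ε / 4` arise: the
  -- average of `f - g`, the ergodic error for `g`, and the difference of the means.
  obtain ⟨g, hg, hgm⟩ := (memLp_one_iff_integrable.2 hf).exists_simpleFunc_eLpNorm_sub_lt
    ENNReal.one_ne_top (ε := ENNReal.ofReal (ε / 4)) (by simpa using by positivity)
  have hgi : Integrable g μ := memLp_one_iff_integrable.1 hgm
  have hg2 : MemLp g 2 μ := SimpleFunc.memLp_of_isFiniteMeasure g 2 μ
  have hd : Integrable (fun x => f x - g x) μ := hf.sub hgi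
  have hfg : ∫ x, |f x - g x| ∂μ < ε / 4 := by
    have : ∫ x, |f x - g x| ∂μ = (eLpNorm (fun x => f x - g x) 1 μ).toReal := by
      rw [eLpNorm_one_eq_lintegral_enorm, ← integral_norm_eq_lintegral_enorm
        hd.aestronglyMeasurable]
      rfl
    rw [this]
    exact (ENNReal.lt_ofReal_iff_toReal_lt hg.ne_top).1 hg
  obtain ⟨n₀, hn₀⟩ := Metric.tendsto_atTop.1
    (hT.tendsto_integral_abs_orbitAverage_of_memLp_two hg2) (ε / 4) (by positivity)
  refine ⟨n₀, fun n hn => ?_⟩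
  have h1 := hn₀ n hn
  rw [Real.dist_eq, sub_zero, abs_of_nonneg (integral_nonneg fun x => abs_nonneg _)] at h1 ⊢
  have h2 := (hTm.integral_abs_orbitAverage_le hd n).trans_lt hfg
  have h3 : |∫ x, f x ∂μ - ∫ x, g x ∂μ| < ε / 4 := by
    rw [← integral_sub hf hgi]
    exact abs_integral_le_integral_abs.trans_lt hfg
  have i1 := (hTm.integrable_orbitAverage hd n).abs
  have i2 : Integrable (fun x => |orbitAverage T g n x - ∫ x, g x ∂μ|) μ :=
    ((hTm.integrable_orbitAverage hgi n).sub (integrable_const (∫ x, g x ∂μ))).abs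
  have hsub : ∀ x, orbitAverage T f n x
      = orbitAverage T (fun x => f x - g x) n x + orbitAverage T g n x := fun x => by
    rw [← orbitAverage_add]; simp
  calc ∫ x, |orbitAverage T f n x - ∫ y, f y ∂μ| ∂μ
      ≤ ∫ x, (|orbitAverage T (fun x => f x - g x) n x|
          + |orbitAverage T g n x - ∫ y, g y ∂μ| + |∫ x, f x ∂μ - ∫ x, g x ∂μ|) ∂μ := by
        refine integral_mono ((hTm.integrable_orbitAverage hf n).sub (integrable_const _)).abs
          ((i1.add i2).add (integrable_const _)) fun x => ?_
        simp only [hsub]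
        refine le_trans (le_of_eq ?_) ((abs_sub _ _).trans (add_le_add_left (abs_add_le _ _) _))
        congr 1
        ring
    _ = ∫ x, |orbitAverage T (fun x => f x - g x) n x| ∂μ
          + ∫ x, |orbitAverage T g n x - ∫ y, g y ∂μ| ∂μ + |∫ x, f x ∂μ - ∫ x, g x ∂μ| := by
        rw [integral_add (i1.fun_add i2) (integrable_const _), integral_add i1 i2]
        simp
    _ < ε := by linarith

theorem Ergodic.tendstoInMeasure_orbitAverage [IsProbabilityMeasure μ]
    (hT : Ergodic T μ) {f : α → ℝ} (hf : Integrable f μ) :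
    TendstoInMeasure μ (fun n x => orbitAverage T f n x - ∫ y, f y ∂μ) atTop (fun _ => 0) :=
  tendstoInMeasure_zero_of_integral_abs
    (Eventually.of_forall fun n =>
      (hT.toMeasurePreserving.integrable_orbitAverage hf n).sub (integrable_const _))
    (hT.tendsto_integral_abs_orbitAverage hf)

/-- A square integrable function exceeds `√n` with probability `o(1/n)`. -/
theorem MeasureTheory.MemLp.tendsto_mul_measure_sqrt_lt {N : α → ℝ} (hN : Measurable N)
    (h2 : MemLp N 2 μ) :
    Tendsto (fun n : ℕ => (n : ENNReal) * μ {x | √(n : ℝ) < N x}) atTop (𝓝 0) := by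
  have hfin : ∫⁻ x, ENNReal.ofReal (N x ^ 2) ∂μ < ⊤ := by
    have := h2.integrable_sq
    exact (hasFiniteIntegral_iff_ofReal (by filter_upwards with x using sq_nonneg _)).1 this.2
  -- Where `√n < N` one has `n ≤ N²`, so `n μ{√n < N}` is at most the tail integral of `N²`, which
  -- vanishes by dominated convergence.
  have hlim : Tendsto (fun n : ℕ => ∫⁻ x, {x | √(n : ℝ) < N x}.indicator
      (fun x => ENNReal.ofReal (N x ^ 2)) x ∂μ) atTop (𝓝 (∫⁻ _, 0 ∂μ)) := by
    refine tendsto_lintegral_of_dominated_convergence (fun x => ENNReal.ofReal (N x ^ 2))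
      (fun n => ?_) (fun n => ?_) hfin.ne ?_
    · exact ((hN.pow_const 2).ennreal_ofReal).indicator (measurableSet_lt measurable_const hN)
    · filter_upwards with x
      exact Set.indicator_le_self _ _ x
    · filter_upwards with x
      refine tendsto_const_nhds.congr' ?_
      obtain ⟨k, hk⟩ := exists_nat_ge (N x ^ 2)
      filter_upwards [eventually_ge_atTop k] with n hn
      refine (Set.indicator_of_notMem ?_ _).symm
      simp only [Set.mem_ofPred_eq, not_lt]
      refine Real.le_sqrt_of_sq_le (hk.trans ?_)
      exact_mod_cast hn
  rw [lintegral_zero] at hlim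
  refine tendsto_of_tendsto_of_tendsto_of_le_of_le tendsto_const_nhds hlim (fun _ => zero_le)
    fun n => ?_
  have hs : MeasurableSet {x | √(n : ℝ) < N x} := measurableSet_lt measurable_const hN
  show (n : ENNReal) * μ {x | √(n : ℝ) < N x} ≤ _
  rw [lintegral_indicator hs, ← setLIntegral_const]
  refine setLIntegral_mono' hs fun x hx => ?_
  rw [← ENNReal.ofReal_natCast]
  refine ENNReal.ofReal_le_ofReal ?_
  have h3 : √(n : ℝ) < N x := hx
  rw [← Real.sq_sqrt (Nat.cast_nonneg n)]
  gcongr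

/-- Averages along an orbit of functions that tend to zero in mean where a fixed square integrable
function `N` is at most `√n`. -/
theorem MeasureTheory.MeasurePreserving.tendstoInMeasure_orbitAverage_zero
    (hT : MeasurePreserving T μ μ) {N : α → ℝ} (hN : Measurable N) (h2 : MemLp N 2 μ)
    {F : ℕ → α → ℝ}
    (hF : ∀ᶠ n : ℕ in atTop, Integrable ({x | N x ≤ √(n : ℝ)}.indicator (F n)) μ)
    (hlim : Tendsto (fun n : ℕ => ∫ x, |{x | N x ≤ √(n : ℝ)}.indicator (F n) x| ∂μ)
      atTop (𝓝 0)) :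
    TendstoInMeasure μ (fun n x => orbitAverage T (F n) n x) atTop (fun _ => 0) := by
  have h1 : TendstoInMeasure μ
      (fun (n : ℕ) x => orbitAverage T ({x | N x ≤ √(n : ℝ)}.indicator (F n)) n x)
      atTop (fun _ => 0) := by
    refine tendstoInMeasure_zero_of_integral_abs
      (hF.mono fun n hn => hT.integrable_orbitAverage hn n) ?_
    refine tendsto_of_tendsto_of_tendsto_of_le_of_le' tendsto_const_nhds hlim
      (Eventually.of_forall fun n => integral_nonneg fun x => abs_nonneg _) ?_
    filter_upwards [hF] with n hn using hT.integral_abs_orbitAverage_le hn n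
  rw [tendstoInMeasure_zero_iff] at h1 ⊢
  intro ε hε
  have h3 := (h1 ε hε).add (h2.tendsto_mul_measure_sqrt_lt hN)
  rw [add_zero] at h3
  refine tendsto_of_tendsto_of_tendsto_of_le_of_le tendsto_const_nhds h3 (fun _ => zero_le)
    fun n => ?_
  -- Truncation alters the average only if `N` exceeds `√n` at one of the `n` visited points; a
  -- union bound and invariance control this event.
  have hU : μ (⋃ i ∈ Finset.Icc 1 n, T^[i] ⁻¹' {x | √(n : ℝ) < N x})
      ≤ (n : ENNReal) * μ {x | √(n : ℝ) < N x} := by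
    refine (measure_biUnion_finset_le _ _).trans (le_of_eq ?_)
    rw [Finset.sum_congr rfl fun i _ => (hT.iterate i).measure_preimage
      (measurableSet_lt measurable_const hN).nullMeasurableSet]
    simp
  refine le_trans (measure_mono fun x hx => ?_)
    ((measure_union_le _ _).trans (add_le_add_right hU _))
  by_cases hx' : x ∈ ⋃ i ∈ Finset.Icc 1 n, T^[i] ⁻¹' {x | √(n : ℝ) < N x}
  · exact Or.inr hx'
  · left
    have : orbitAverage T ({x | N x ≤ √(n : ℝ)}.indicator (F n)) n x
        = orbitAverage T (F n) n x := by
      simp only [orbitAverage]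
      congr 1
      refine Finset.sum_congr rfl fun i hi => Set.indicator_of_mem ?_ _
      simp only [Set.mem_iUnion, not_exists, Set.mem_preimage, Set.mem_ofPred_eq] at hx' ⊢
      exact not_lt.1 (hx' i hi)
    simpa only [Set.mem_ofPred_eq, this] using hx

end Ergodic

namespace ArchModel

/-! ### Differentiability and growth of one summand. -/

section Calculus

theorem fderiv_eq_sum_partialDeriv {k : ℕ} (g : Par k → ℝ) (a w : Par k) :
    fderiv ℝ g a w = ∑ j, w j * partialDeriv g j a := by
  have : w = ∑ j, w j • EuclideanSpace.single j (1 : ℝ) := by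
    ext i
    simp [Finset.sum_apply, Pi.single_apply]
  conv_lhs => rw [this]
  simp [partialDeriv]

theorem norm_fderiv_le_of_partialDeriv {k : ℕ} {g : Par k → ℝ} {a : Par k} {B : ℝ} (hB : 0 ≤ B)
    (h : ∀ j, |partialDeriv g j a| ≤ B) : ‖fderiv ℝ g a‖ ≤ k * B := by
  refine ContinuousLinearMap.opNorm_le_bound _ (by positivity) fun w => ?_
  rw [fderiv_eq_sum_partialDeriv, Real.norm_eq_abs]
  calc |∑ j, w j * partialDeriv g j a| ≤ ∑ j : Fin k, ‖w‖ * B := by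
        refine (Finset.abs_sum_le_sum_abs _ _).trans (Finset.sum_le_sum fun j _ => ?_)
        rw [abs_mul]
        exact mul_le_mul (PiLp.norm_apply_le w j) (h j) (abs_nonneg _) (norm_nonneg _)
    _ = k * B * ‖w‖ := by simp; ring

/-- Mean value inequality on the convex ball; the factor `k` bounds the norm of the gradient by its
components. -/
theorem abs_sub_le_of_partialDeriv_le {k : ℕ} {g : Par k → ℝ} {a x : Par k} {r B : ℝ} (hB : 0 ≤ B)
    (hd : ∀ y ∈ Metric.closedBall a r, DifferentiableAt ℝ g y)
    (h : ∀ y ∈ Metric.closedBall a r, ∀ j, |partialDeriv g j y| ≤ B)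
    (hx : ‖x - a‖ ≤ r) : |g x - g a| ≤ k * B * ‖x - a‖ := by
  have hr : 0 ≤ r := (norm_nonneg _).trans hx
  exact (convex_closedBall a r).norm_image_sub_le_of_norm_fderiv_le hd
    (fun y hy => norm_fderiv_le_of_partialDeriv hB (h y hy)) (Metric.mem_closedBall_self hr)
    (by simpa [dist_eq_norm] using hx)

/-- First order expansion along local sequences at rate `√n`. -/
theorem tendsto_sqrt_mul_sub_sub {E : Type*} [NormedAddCommGroup E] [NormedSpace ℝ E] {F : E → ℝ}
    {L : E →L[ℝ] ℝ} {x : E} (hF : HasFDerivAt F L x) {w : ℕ → E} {C : ℝ} (hw : ∀ n, ‖w n‖ ≤ C) :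
    Tendsto (fun n : ℕ => √(n : ℝ) * (F (x + (√(n : ℝ))⁻¹ • w n) - F x) - L (w n))
      atTop (𝓝 0) := by
  have hs : Tendsto (fun n : ℕ => (√(n : ℝ))⁻¹) atTop (𝓝 0) :=
    tendsto_inv_atTop_zero.comp (Real.tendsto_sqrt_atTop.comp tendsto_natCast_atTop_atTop)
  have hz : Tendsto (fun n : ℕ => (√(n : ℝ))⁻¹ • w n) atTop (𝓝 0) := by
    rw [tendsto_zero_iff_norm_tendsto_zero]
    refine squeeze_zero (fun n => norm_nonneg _) (fun n => ?_)
      (by simpa using hs.mul_const C)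
    rw [norm_smul, Real.norm_of_nonneg (by positivity)]
    gcongr
    exact hw n
  -- The Taylor remainder is `o(‖w n‖/√n)`, hence `o(1/√n)`: boundedness of `w` suffices, and `w`
  -- need not converge.
  have hlo := (hasFDerivAt_iff_isLittleO_nhds_zero.1 hF).comp_tendsto hz
  have hO : (fun n : ℕ => (√(n : ℝ))⁻¹ • w n) =O[atTop] fun n : ℕ => (√(n : ℝ))⁻¹ := by
    refine Asymptotics.IsBigO.of_bound C (Eventually.of_forall fun n => ?_)
    rw [norm_smul, mul_comm]
    gcongr
    exact hw n
  refine (hlo.trans_isBigO hO).tendsto_div_nhds_zero.congr' ?_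
  filter_upwards [eventually_ge_atTop 1] with n hn
  have : 0 < √(n : ℝ) := by positivity
  simp only [Function.comp_apply, map_smul, smul_eq_mul]
  field_simp

/-- The derivative in the parameters of one summand of the statistics. -/
theorem exists_hasFDerivAt_summand {ℓ p : ℕ} {m : Par ℓ → ℝ} {σ : Par p → ℝ} {g : ℝ → ℝ}
    {a : Par ℓ} {b : Par p} (hm : DifferentiableAt ℝ m a) (hσ : DifferentiableAt ℝ σ b)
    (hσ0 : σ b ≠ 0) {e y H : ℝ} (he : (y - m a) / σ b = e) (hg : DifferentiableAt ℝ g e) :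
    ∃ L : Par ℓ × Par p →L[ℝ] ℝ,
      HasFDerivAt (fun x : Par ℓ × Par p => g ((y - m x.1) / σ x.2) * (H / σ x.2)) L (a, b) ∧
      ∀ u v, L (u, v) = -(fderiv ℝ m a u / σ b * (deriv g e * H / σ b)) -
        fderiv ℝ σ b v / σ b * ((e * deriv g e + g e) * H / σ b) := by
  have hm1 : HasFDerivAt (fun x : Par ℓ × Par p => m x.1)
      ((fderiv ℝ m a).comp (ContinuousLinearMap.fst ℝ _ _)) (a, b) :=
    HasFDerivAt.comp (g := m) (a, b) hm.hasFDerivAt hasFDerivAt_fst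
  have hs1 : HasFDerivAt (fun x : Par ℓ × Par p => σ x.2)
      ((fderiv ℝ σ b).comp (ContinuousLinearMap.snd ℝ _ _)) (a, b) :=
    HasFDerivAt.comp (g := σ) (a, b) hσ.hasFDerivAt hasFDerivAt_snd
  have hinv : HasFDerivAt (fun x : Par ℓ × Par p => (σ x.2)⁻¹) _ (a, b) :=
    HasDerivAt.comp_hasFDerivAt (h₂ := fun t : ℝ => t⁻¹) (a, b) (hasDerivAt_inv hσ0) hs1
  have hres := (hm1.const_sub y).mul hinv
  have hg' : HasDerivAt g (deriv g e) ((y - m a) * (σ b)⁻¹) := by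
    rw [← div_eq_mul_inv, he]; exact hg.hasDerivAt
  have hgc := HasDerivAt.comp_hasFDerivAt (h₂ := g) (a, b) hg' hres
  -- The scale enters twice: through the residual, giving `e * deriv g e`, and through the weight
  -- `H/σ`, giving `g e`.
  have hall := hgc.mul (hinv.const_mul H)
  refine ⟨_, hall.congr_of_eventuallyEq (Eventually.of_forall fun x => ?_), fun u v => ?_⟩
  · simp [div_eq_mul_inv]
  · have hy : y - m a = e * σ b := by rw [← he]; field_simp
    simp only [Function.comp_apply, Pi.mul_apply, hy, mul_inv_cancel_right₀ hσ0,
      add_apply, smul_apply,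
      ContinuousLinearMap.comp_apply, neg_apply, smul_eq_mul,
      ContinuousLinearMap.coe_fst', ContinuousLinearMap.coe_snd']
    field_simp
    ring

/-- A function with bounded second derivative grows at most quadratically. -/
theorem exists_growth_of_deriv_deriv_bounded {g : ℝ → ℝ} (hg : Differentiable ℝ g)
    (hg' : Differentiable ℝ (deriv g)) (hb : ∃ C : ℝ, ∀ x, |deriv (deriv g) x| ≤ C) :
    ∃ c : ℝ, 0 ≤ c ∧ (∀ x, |deriv g x| ≤ c * (1 + |x|)) ∧
      (∀ x, |g x| ≤ c * (1 + |x|) ^ 2) ∧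
      ∀ x y, |g y - g x| ≤ c * (1 + |x| + |y|) * |y - x| := by
  obtain ⟨C, hC⟩ := hb
  have hC0 : 0 ≤ C := (abs_nonneg _).trans (hC 0)
  set c := C + |deriv g 0| with hc
  have hc0 : 0 ≤ c := by positivity
  have h1 : ∀ x, |deriv g x| ≤ c * (1 + |x|) := fun x => by
    have := convex_univ.norm_image_sub_le_of_norm_deriv_le (fun y _ => hg' y) (fun y _ => hC y)
      (Set.mem_univ 0) (Set.mem_univ x)
    simp only [Real.norm_eq_abs, sub_zero] at this
    have h2 := abs_sub_abs_le_abs_sub (deriv g x) (deriv g 0)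
    nlinarith [abs_nonneg x, abs_nonneg (deriv g 0), mul_nonneg (abs_nonneg x)
      (abs_nonneg (deriv g 0))]
  have h3 : ∀ x y, |g y - g x| ≤ c * (1 + |x| + |y|) * |y - x| := fun x y => by
    refine (convex_uIcc x y).norm_image_sub_le_of_norm_deriv_le (fun z _ => hg z) (fun z hz => ?_)
      Set.left_mem_uIcc Set.right_mem_uIcc
    refine (h1 z).trans ?_
    refine mul_le_mul_of_nonneg_left ?_ hc0
    -- A point `z` between `x` and `y` satisfies `|z| ≤ |x| + |y|`.
    rcases Set.mem_uIcc.1 hz with h | h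
    · rcases abs_cases z with h' | h' <;> rcases abs_cases x with h'' | h'' <;>
        rcases abs_cases y with h''' | h''' <;> linarith
    · rcases abs_cases z with h' | h' <;> rcases abs_cases x with h'' | h'' <;>
        rcases abs_cases y with h''' | h''' <;> linarith
  refine ⟨c + |g 0|, by positivity, fun x => ?_, fun x => ?_, fun x y => ?_⟩
  · refine (h1 x).trans ?_
    gcongr
    linarith [abs_nonneg (g 0)]
  · have h4 := h3 0 x
    have h5 := abs_sub_abs_le_abs_sub (g x) (g 0)
    simp only [abs_zero, add_zero, sub_zero] at h4
    nlinarith [abs_nonneg x, abs_nonneg (g 0), mul_nonneg (abs_nonneg x) (abs_nonneg (g 0)),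
      mul_nonneg hc0 (abs_nonneg x), mul_nonneg (abs_nonneg (g 0)) (sq_nonneg x), sq_abs x]
  · refine (h3 x y).trans ?_
    gcongr
    linarith [abs_nonneg (g 0)]

/-- Change of one summand of the statistics under a small relative change of location and scale. -/
theorem abs_summand_sub_le {g : ℝ → ℝ} {c : ℝ} (hc : 0 ≤ c)
    (hg : ∀ x, |g x| ≤ c * (1 + |x|) ^ 2)
    (hlip : ∀ x y, |g y - g x| ≤ c * (1 + |x| + |y|) * |y - x|)
    {κ η m₀ m₁ s₀ s₁ e H : ℝ} (hκ : 0 ≤ κ) (hη : 0 ≤ η) (hη1 : η ≤ 1) (hs₀ : 0 < s₀) (hs₁ : 0 < s₁)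
    (hm : |m₁ - m₀| ≤ κ * η * s₁) (hs : |s₁ - s₀| ≤ κ * η * s₁) :
    |g ((m₀ + s₀ * e - m₁) / s₁) * (H / s₁) - g e * (H / s₀)| ≤
      c * κ * ((2 + κ) * (1 + κ) + 1) * (η * |H / s₀| * (1 + |e|) ^ 2) := by
  set e' := (m₀ + s₀ * e - m₁) / s₁ with he'
  have ha : 0 ≤ |e| := abs_nonneg e
  have hΔ : |e' - e| ≤ κ * η * (1 + |e|) := by
    have : e' - e = -((m₁ - m₀) / s₁) - (s₁ - s₀) / s₁ * e := by rw [he']; field_simp; ring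
    rw [this]
    have h1 : |(m₁ - m₀) / s₁| ≤ κ * η := by
      rw [abs_div, abs_of_pos hs₁, div_le_iff₀ hs₁]; exact hm
    have h2 : |(s₁ - s₀) / s₁| ≤ κ * η := by
      rw [abs_div, abs_of_pos hs₁, div_le_iff₀ hs₁]; exact hs
    calc |-((m₁ - m₀) / s₁) - (s₁ - s₀) / s₁ * e|
        ≤ |-((m₁ - m₀) / s₁)| + |(s₁ - s₀) / s₁ * e| := abs_sub _ _
      _ ≤ κ * η + κ * η * |e| := by rw [abs_neg, abs_mul]; gcongr
      _ = κ * η * (1 + |e|) := by ring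
  have hκη : κ * η ≤ κ := mul_le_of_le_one_right hκ hη1
  have he'b : |e'| ≤ |e| + κ * (1 + |e|) := by
    have := abs_sub_abs_le_abs_sub e' e
    have h2 : κ * η * (1 + |e|) ≤ κ * (1 + |e|) := by gcongr
    linarith
  -- The factor `2 + κ` comes from `1 + |e| + |e'| ≤ 1 + 2|e| + κ(1 + |e|)`.
  have hgd : |g e' - g e| ≤ c * (2 + κ) * κ * η * (1 + |e|) ^ 2 := by
    refine (hlip e e').trans ?_
    have h1 : 1 + |e| + |e'| ≤ (2 + κ) * (1 + |e|) := by nlinarith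
    calc c * (1 + |e| + |e'|) * |e' - e|
        ≤ c * ((2 + κ) * (1 + |e|)) * (κ * η * (1 + |e|)) := by gcongr
      _ = _ := by ring
  have hr : s₀ / s₁ = 1 - (s₁ - s₀) / s₁ := by field_simp; ring
  have hr0 : |(s₁ - s₀) / s₁| ≤ κ * η := by
    rw [abs_div, abs_of_pos hs₁, div_le_iff₀ hs₁]; exact hs
  have hr1 : |s₀ / s₁| ≤ 1 + κ := by
    rw [hr]
    refine (abs_sub _ _).trans ?_
    rw [abs_one]
    linarith
  have hr2 : |s₀ / s₁ - 1| ≤ κ * η := by rw [hr, sub_sub_cancel_left, abs_neg]; exact hr0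
  -- Everything is expressed through `H / s₀`, the weight with known moments. The change of `g`
  -- contributes `(2 + κ)(1 + κ)` to the constant, the change of scale contributes `1`.
  have hdecomp : g e' * (H / s₁) - g e * (H / s₀)
      = ((g e' - g e) * (s₀ / s₁) + g e * (s₀ / s₁ - 1)) * (H / s₀) := by field_simp; ring
  rw [hdecomp, abs_mul]
  calc |(g e' - g e) * (s₀ / s₁) + g e * (s₀ / s₁ - 1)| * |H / s₀|
      ≤ (c * (2 + κ) * κ * η * (1 + |e|) ^ 2 * (1 + κ) + c * (1 + |e|) ^ 2 * (κ * η))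
        * |H / s₀| := by
        gcongr
        refine (abs_add_le _ _).trans ?_
        rw [abs_mul, abs_mul]
        have := hg e
        gcongr
    _ = _ := by ring

end Calculus

/-! ### From deterministic sequences to discretised estimators. -/

/-- For locally discrete root-`n` consistent estimators, convergence in probability along all
deterministic local sequences carries over to the estimators. -/
theorem tendstoInMeasure_of_locallyDiscrete {Ω : Type*} [MeasurableSpace Ω] {P : Measure Ω}
    {ℓ p : ℕ} {a : Par ℓ} {b : Par p} {ρhat : ℕ → Ω → Par ℓ} {θhat : ℕ → Ω → Par p}
    (hρcons : RootNConsistent P ρhat a) (hθcons : RootNConsistent P θhat b)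
    (hρdisc : LocallyDiscrete ρhat a) (hθdisc : LocallyDiscrete θhat b)
    {R : ℕ → Par ℓ → Par p → Ω → ℝ}
    (hR : ∀ (u : ℕ → Par ℓ) (v : ℕ → Par p), (∃ C : ℝ, ∀ n, ‖u n‖ ^ 2 + ‖v n‖ ^ 2 ≤ C) →
      TendstoInMeasure P (fun (n : ℕ) ω =>
        R n (a + (√(n : ℝ))⁻¹ • u n) (b + (√(n : ℝ))⁻¹ • v n) ω) atTop (fun _ => 0)) :
    TendstoInMeasure P (fun n ω => R n (ρhat n ω) (θhat n ω) ω) atTop (fun _ => 0) := by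
  rw [tendstoInMeasure_zero_iff]
  intro ε hε
  -- Uniformity over local parameters in a ball: for each `n` choose a pair violating the bound if
  -- there is one. The chosen pairs form bounded sequences, so `hR` shows that violations eventually
  -- stop.
  have hunif : ∀ (c : ℝ) (δ : ENNReal), 0 < δ → ∀ᶠ n : ℕ in atTop, ∀ (u : Par ℓ) (v : Par p),
      ‖u‖ ≤ c → ‖v‖ ≤ c →
      P {ω | ε ≤ |R n (a + (√(n : ℝ))⁻¹ • u) (b + (√(n : ℝ))⁻¹ • v) ω|} ≤ δ := by
    intro c δ hδ
    rcases lt_or_ge c 0 with hc | hc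
    · exact Eventually.of_forall fun n u v hu => absurd hu (not_le.2 (hc.trans_le (norm_nonneg _)))
    have hex : ∀ n : ℕ, ∃ w : Par ℓ × Par p, ‖w.1‖ ≤ c ∧ ‖w.2‖ ≤ c ∧
        (P {ω | ε ≤ |R n (a + (√(n : ℝ))⁻¹ • w.1) (b + (√(n : ℝ))⁻¹ • w.2) ω|} ≤ δ →
          ∀ (u : Par ℓ) (v : Par p), ‖u‖ ≤ c → ‖v‖ ≤ c →
          P {ω | ε ≤ |R n (a + (√(n : ℝ))⁻¹ • u) (b + (√(n : ℝ))⁻¹ • v) ω|} ≤ δ) := by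
      intro n
      by_cases h : ∀ (u : Par ℓ) (v : Par p), ‖u‖ ≤ c → ‖v‖ ≤ c →
          P {ω | ε ≤ |R n (a + (√(n : ℝ))⁻¹ • u) (b + (√(n : ℝ))⁻¹ • v) ω|} ≤ δ
      · exact ⟨0, by simpa using hc, by simpa using hc, fun _ => h⟩
      · push Not at h
        obtain ⟨u, v, hu, hv, h⟩ := h
        exact ⟨(u, v), hu, hv, fun h' => absurd h' (not_le.2 h)⟩
    choose w hw1 hw2 hw3 using hex
    have := hR (fun n => (w n).1) (fun n => (w n).2) ⟨c ^ 2 + c ^ 2, fun n => by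
      gcongr
      · exact hw1 n
      · exact hw2 n⟩
    rw [tendstoInMeasure_zero_iff] at this
    filter_upwards [(this ε hε).eventually_le_const hδ] with n hn using hw3 n hn
  rw [ENNReal.tendsto_atTop_zero]
  intro δ hδ
  rcases eq_or_ne δ ⊤ with rfl | hδt
  · exact ⟨0, fun n _ => le_top⟩
  have hδ0 : 0 < δ.toReal := ENNReal.toReal_pos hδ.ne' hδt
  have hδ4 : 0 < δ.toReal / 4 := by positivity
  obtain ⟨η₁, n₁, h₁⟩ := hρcons _ hδ4
  obtain ⟨η₂, n₂, h₂⟩ := hθcons _ hδ4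
  -- The maximum with `1` makes the radius positive, as local discreteness requires.
  set c := max (max η₁ η₂) 1 with hc
  have hc0 : 0 < c := lt_of_lt_of_le one_pos (le_max_right _ _)
  obtain ⟨B₁, n₃, h₃⟩ := hρdisc c hc0
  obtain ⟨B₂, n₄, h₄⟩ := hθdisc c hc0
  -- Budget: `δ/4` for each consistency failure and `δ/2` shared among at most `B₁ * B₂` pairs of
  -- values; the `+ 1` avoids dividing by zero.
  have hpos : (0 : ENNReal) < ENNReal.ofReal (δ.toReal / 2 / (B₁ * B₂ + 1)) := by
    rw [ENNReal.ofReal_pos]; positivity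
  obtain ⟨n₅, h₅⟩ := eventually_atTop.1 (hunif c _ hpos)
  refine ⟨max (max (max n₁ n₂) (max n₃ n₄)) (max n₅ 1), fun n hn => ?_⟩
  simp only [max_le_iff] at hn
  obtain ⟨⟨⟨hn₁, hn₂⟩, hn₃, hn₄⟩, hn₅, hn1⟩ := hn
  have hs : 0 < √(n : ℝ) := by positivity
  have hf₁ := Set.finite_of_encard_le_coe (h₃ n hn₃)
  have hf₂ := Set.finite_of_encard_le_coe (h₄ n hn₄)
  set S₁ := hf₁.toFinset with hS₁
  set S₂ := hf₂.toFinset with hS₂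
  have hcard₁ : S₁.card ≤ B₁ := by
    have := h₃ n hn₃
    rw [hf₁.encard_eq_coe_toFinset_card] at this
    exact_mod_cast this
  have hcard₂ : S₂.card ≤ B₂ := by
    have := h₄ n hn₄
    rw [hf₂.encard_eq_coe_toFinset_card] at this
    exact_mod_cast this
  have hpt : ∀ x ∈ S₁ ×ˢ S₂, P {ω | ε ≤ |R n x.1 x.2 ω|} ≤
      ENNReal.ofReal (δ.toReal / 2 / (B₁ * B₂ + 1)) := by
    rintro ⟨r, t⟩ hx
    simp only [Finset.mem_product, hS₁, hS₂, Set.Finite.mem_toFinset, Set.mem_inter_iff,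
      Set.mem_ofPred_eq] at hx
    have := h₅ n hn₅ (√(n : ℝ) • (r - a)) (√(n : ℝ) • (t - b))
      (by rw [norm_smul, Real.norm_of_nonneg hs.le]; exact hx.1.2)
      (by rw [norm_smul, Real.norm_of_nonneg hs.le]; exact hx.2.2)
    simpa [smul_smul, inv_mul_cancel₀ hs.ne'] using this
  have hsub : {ω | ε ≤ |R n (ρhat n ω) (θhat n ω) ω|} ⊆
      ({ω | η₁ < √(n : ℝ) * ‖ρhat n ω - a‖} ∪ {ω | η₂ < √(n : ℝ) * ‖θhat n ω - b‖}) ∪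
      ⋃ x ∈ S₁ ×ˢ S₂, {ω | ε ≤ |R n x.1 x.2 ω|} := by
    intro ω hω
    by_cases hA : η₁ < √(n : ℝ) * ‖ρhat n ω - a‖
    · exact Or.inl (Or.inl hA)
    by_cases hB : η₂ < √(n : ℝ) * ‖θhat n ω - b‖
    · exact Or.inl (Or.inr hB)
    right
    refine Set.mem_biUnion (x := (ρhat n ω, θhat n ω)) ?_ hω
    simp only [Finset.coe_product, Set.mem_prod, Finset.mem_coe, hS₁, hS₂,
      Set.Finite.mem_toFinset, Set.mem_inter_iff, Set.mem_range_self, true_and, Set.mem_ofPred_eq]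
    exact ⟨(not_lt.1 hA).trans ((le_max_left _ _).trans (le_max_left _ _)),
      (not_lt.1 hB).trans ((le_max_right _ _).trans (le_max_left _ _))⟩
  calc P {ω | ε ≤ |R n (ρhat n ω) (θhat n ω) ω|}
      ≤ (ENNReal.ofReal (δ.toReal / 4) + ENNReal.ofReal (δ.toReal / 4)) +
        ∑ x ∈ S₁ ×ˢ S₂, P {ω | ε ≤ |R n x.1 x.2 ω|} := by
        refine (measure_mono hsub).trans ((measure_union_le _ _).trans ?_)
        gcongr
        · exact (measure_union_le _ _).trans (add_le_add (h₁ n hn₁) (h₂ n hn₂))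
        · exact measure_biUnion_finset_le _ _
    _ ≤ (ENNReal.ofReal (δ.toReal / 4) + ENNReal.ofReal (δ.toReal / 4)) +
        ENNReal.ofReal (δ.toReal / 2) := by
        gcongr
        refine (Finset.sum_le_card_nsmul _ _ _ hpt).trans ?_
        rw [nsmul_eq_mul, ← ENNReal.ofReal_natCast, ← ENNReal.ofReal_mul (by positivity)]
        refine ENNReal.ofReal_le_ofReal ?_
        have hcard : ((S₁ ×ˢ S₂).card : ℝ) ≤ B₁ * B₂ + 1 := by
          rw [Finset.card_product]
          push_cast
          have : (S₁.card : ℝ) * S₂.card ≤ B₁ * B₂ := by gcongr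
          linarith
        rw [mul_div_assoc', div_le_iff₀ (by positivity), mul_comm]
        gcongr
    _ = δ := by
        rw [← ENNReal.ofReal_add hδ4.le hδ4.le, ← ENNReal.ofReal_add (by positivity) (by positivity)]
        rw [show δ.toReal / 4 + δ.toReal / 4 + δ.toReal / 2 = δ.toReal by ring,
          ENNReal.ofReal_toReal hδt]

/-! ### The statistics on the path space. -/

variable {s q d ℓ p : ℕ} {Ω : Type*}

/-- The first coordinate process on the space of paths. -/
noncomputable def coordY {d : ℕ} (i : ℤ) (w : ℤ → ℝ × (Fin d → ℝ)) : ℝ := (w i).1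

/-- The second coordinate process on the space of paths. -/
noncomputable def coordX {d : ℕ} (i : ℤ) (w : ℤ → ℝ × (Fin d → ℝ)) : Fin d → ℝ := (w i).2

/-- The common form of the two statistics, for a score `g` and a direction `H`. -/
noncomputable def Spec.stat (M : Spec s q d ℓ p) (Y : ℤ → Ω → ℝ) (X : ℤ → Ω → Fin d → ℝ) (g : ℝ → ℝ)
    (H : Reg s q d → ℝ) (h : ℝ) (n : ℕ) (ρ : Par ℓ) (θ : Par p) (ω : Ω) : ℝ :=
  -(√(n : ℝ))⁻¹ * ∑ i ∈ Finset.Icc 1 n, h * g (M.residual Y X ρ θ (i : ℤ) ω) *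
    (H (regressor s q Y X (i : ℤ) ω) / M.σ θ (regressor s q Y X (i : ℤ) ω))

/-- `(∂σ(θ₀,Z₀)/∂θ_k / σ(θ₀,Z₀)) · g(ε₀) H(Z₀) / σ(θ₀,Z₀)`. -/
noncomputable def Spec.noiseTerm (M : Spec s q d ℓ p) (Y : ℤ → Ω → ℝ) (X : ℤ → Ω → Fin d → ℝ)
    (ε : ℤ → Ω → ℝ) (g : ℝ → ℝ) (H : Reg s q d → ℝ) (k : Fin p) (ω : Ω) : ℝ :=
  partialDeriv (fun t => M.σ t (regressor s q Y X 0 ω)) k M.θ₀ /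
      M.σ M.θ₀ (regressor s q Y X 0 ω) *
    (g (ε 0 ω) * H (regressor s q Y X 0 ω) / M.σ M.θ₀ (regressor s q Y X 0 ω))

theorem shift_iterate_apply {E : Type*} (n : ℕ) (w : ℤ → E) (j : ℤ) :
    (shift^[n] w) j = w (j + n) := by
  induction n generalizing j with
  | zero => simp
  | succ n ih =>
    rw [Function.iterate_succ_apply']
    simp only [shift, ih]
    congr 1
    push_cast
    ring

theorem regressor_coord_shift (s q : ℕ) (n : ℕ) (w : ℤ → ℝ × (Fin d → ℝ)) :
    regressor s q coordY coordX (n : ℤ) w = regressor s q coordY coordX 0 (shift^[n] w) := by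
  refine Prod.ext (funext fun k => ?_) (funext fun k => ?_)
  · simp only [regressor, coordY, shift_iterate_apply]
    congr 2
    ring
  · simp only [regressor, coordX, shift_iterate_apply]
    congr 2
    ring

theorem Spec.residual_coord_shift (M : Spec s q d ℓ p) (ρ : Par ℓ) (θ : Par p) (n : ℕ)
    (w : ℤ → ℝ × (Fin d → ℝ)) :
    M.residual coordY coordX ρ θ (n : ℤ) w = M.residual coordY coordX ρ θ 0 (shift^[n] w) := by
  simp only [Spec.residual, regressor_coord_shift]
  simp only [coordY, shift_iterate_apply, zero_add]

/-- Differences of the statistic are averages along the orbit of the shift. -/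
theorem Spec.stat_sub_eq_orbitAverage (M : Spec s q d ℓ p) (g : ℝ → ℝ) (H : Reg s q d → ℝ) (h : ℝ)
    {n : ℕ} (hn : 1 ≤ n) (ρ : Par ℓ) (θ : Par p) (w : ℤ → ℝ × (Fin d → ℝ)) :
    M.stat coordY coordX g H h n ρ θ w - M.stat coordY coordX g H h n M.ρ₀ M.θ₀ w =
      -h * orbitAverage shift (fun w' => √(n : ℝ) *
        (g (M.residual coordY coordX ρ θ 0 w') *
          (H (regressor s q coordY coordX 0 w') / M.σ θ (regressor s q coordY coordX 0 w')) -
        g (M.residual coordY coordX M.ρ₀ M.θ₀ 0 w') *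
          (H (regressor s q coordY coordX 0 w') /
            M.σ M.θ₀ (regressor s q coordY coordX 0 w')))) n w := by
  have hs : 0 < √(n : ℝ) := by positivity
  -- This turns the `1/√n` normalisation into an average whose integrand carries the factor `√n`.
  have hss : (√(n : ℝ))⁻¹ = (n : ℝ)⁻¹ * √(n : ℝ) := by
    have := Real.mul_self_sqrt (Nat.cast_nonneg (α := ℝ) n)
    field_simp
    rw [sq, this]
  simp only [Spec.stat, orbitAverage, Spec.residual_coord_shift, regressor_coord_shift, hss]
  rw [← mul_sub, ← Finset.sum_sub_distrib, Finset.mul_sum, Finset.mul_sum, Finset.mul_sum]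
  refine Finset.sum_congr rfl fun i _ => ?_
  ring

section Measurability

variable [MeasurableSpace Ω]

theorem measurable_regressor {Y : ℤ → Ω → ℝ} {X : ℤ → Ω → Fin d → ℝ} (hY : ∀ i, Measurable (Y i))
    (hX : ∀ i, Measurable (X i)) (i : ℤ) : Measurable (regressor s q Y X i) :=
  Measurable.prodMk (measurable_pi_lambda _ fun _ => hY _) (measurable_pi_lambda _ fun _ => hX _)

theorem measurable_coordY (i : ℤ) : Measurable (coordY (d := d) i) :=
  (measurable_pi_apply i).fst

theorem measurable_coordX (i : ℤ) : Measurable (coordX (d := d) i) :=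
  (measurable_pi_apply i).snd

theorem Spec.Regular.measurable_residual {M : Spec s q d ℓ p} (hreg : M.Regular)
    {Y : ℤ → Ω → ℝ} {X : ℤ → Ω → Fin d → ℝ} (hY : ∀ i, Measurable (Y i))
    (hX : ∀ i, Measurable (X i)) {ρ : Par ℓ} {θ : Par p} (hρ : ρ ∈ M.Θ₁) (hθ : θ ∈ M.Θ₂) (i : ℤ) :
    Measurable (M.residual Y X ρ θ i) :=
  ((hY i).sub ((hreg.meas_m ρ hρ).comp (measurable_regressor hY hX i))).div
    ((hreg.meas_σ θ hθ).comp (measurable_regressor hY hX i))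

end Measurability

/-- The derivative is a pointwise limit of difference quotients with step `1/√n`. The first `n₀` are
skipped so that the shifted parameter lies in `Θ`, where `F` is measurable. -/
theorem measurable_partialDeriv {α : Type*} [MeasurableSpace α] {k : ℕ} {Θ : Set (Par k)}
    {F : Par k → α → ℝ} (hF : ∀ r ∈ Θ, Measurable (F r)) {a : Par k} (ha : a ∈ interior Θ)
    (hd : ∀ z, DifferentiableAt ℝ (fun r => F r z) a) (j : Fin k) :
    Measurable fun z => partialDeriv (fun r => F r z) j a := by
  set e : Par k := EuclideanSpace.single j 1 with he
  have hs : Tendsto (fun n : ℕ => (√(n : ℝ))⁻¹) atTop (𝓝 0) :=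
    tendsto_inv_atTop_zero.comp (Real.tendsto_sqrt_atTop.comp tendsto_natCast_atTop_atTop)
  have hlim : Tendsto (fun n : ℕ => a + (√(n : ℝ))⁻¹ • e) atTop (𝓝 a) := by
    simpa using (hs.smul_const e).const_add a
  obtain ⟨n₀, hn₀⟩ := eventually_atTop.1 (hlim.eventually (isOpen_interior.mem_nhds ha))
  refine measurable_of_tendsto_metrizable
    (f := fun (n : ℕ) z => √((n + n₀ : ℕ) : ℝ) *
      (F (a + (√((n + n₀ : ℕ) : ℝ))⁻¹ • e) z - F a z)) (fun n => ?_) ?_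
  · exact ((hF _ (interior_subset (hn₀ _ (Nat.le_add_left _ _)))).sub
      (hF _ (interior_subset ha))).const_mul _
  · rw [tendsto_pi_nhds]
    intro z
    have := (tendsto_sqrt_mul_sub_sub (hd z).hasFDerivAt (w := fun _ => e) (C := ‖e‖)
      fun _ => le_rfl).add_const (fderiv ℝ (fun r => F r z) a e)
    simp only [sub_add_cancel, zero_add] at this
    exact this.comp (tendsto_add_atTop_nat n₀)

/-! ### Envelopes from the domination condition. -/

section Domination

variable [MeasurableSpace Ω] {M : Spec s q d ℓ p} {P : Measure Ω}
  {Y : ℤ → Ω → ℝ} {X : ℤ → Ω → Fin d → ℝ}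

/-- The domination condition depends only on the law of the path. -/
theorem Spec.Dominated.map_path {a : ℝ} {B : Set (Par ℓ) → Set (Par p) → Reg s q d → ℝ → Prop}
    (hY : ∀ i, Measurable (Y i)) (hX : ∀ i, Measurable (X i)) (h : M.Dominated P Y X a B) :
    M.Dominated (P.map fun ω (i : ℤ) => (Y i ω, X i ω)) coordY coordX a B := by
  intro u v huv
  obtain ⟨n₀, r₁, r₂, N, μ, hμ, hN, hint⟩ := h u v huv
  refine ⟨n₀, r₁, r₂, N, μ, hμ, hN, ?_⟩
  have hpath : Measurable fun ω (i : ℤ) => (Y i ω, X i ω) :=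
    measurable_pi_lambda _ fun i => (hY i).prodMk (hX i)
  rw [lintegral_map _ hpath]
  · exact hint
  · refine Measurable.pow_const (Measurable.iSup fun n => ?_) _
    exact ((hN n.1 n.2).2.2.2.2.1.comp
      (measurable_regressor measurable_coordY measurable_coordX 0)).ennreal_ofReal

/-- A single square integrable envelope along a local sequence. -/
theorem Spec.Dominated.exists_envelope [IsFiniteMeasure P] (hY : ∀ i, Measurable (Y i))
    (hX : ∀ i, Measurable (X i)) (h : M.Dominated P Y X 2 M.Bound₁) {u : ℕ → Par ℓ}
    {v : ℕ → Par p} (huv : ∃ C : ℝ, ∀ n, ‖u n‖ ^ 2 + ‖v n‖ ^ 2 ≤ C) :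
    ∃ (n₀ : ℕ) (r₁ r₂ : ℕ → ℝ) (N : Reg s q d → ℝ), Measurable N ∧ (∀ z, 0 ≤ N z) ∧
      MemLp (fun ω => N (regressor s q Y X 0 ω)) 2 P ∧
      (∀ n, n₀ ≤ n →
        ‖(√(n : ℝ))⁻¹ • u n‖ ≤ r₁ n ∧ ‖(√(n : ℝ))⁻¹ • v n‖ ≤ r₂ n ∧
        Metric.closedBall M.ρ₀ (r₁ n) ⊆ interior M.Θ₁ ∧
        Metric.closedBall M.θ₀ (r₂ n) ⊆ interior M.Θ₂) ∧
      ∀ᵐ ω ∂P, ∀ n, n₀ ≤ n → M.Bound₁ (Metric.closedBall M.ρ₀ (r₁ n))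
        (Metric.closedBall M.θ₀ (r₂ n)) (regressor s q Y X 0 ω)
        (N (regressor s q Y X 0 ω)) := by
  obtain ⟨n₀, r₁, r₂, N, μ, hμ, hN, hint⟩ := h u v huv
  set E : Reg s q d → ENNReal := fun z => ⨆ n : {n : ℕ // n₀ ≤ n}, ENNReal.ofReal (N n.1 z) with hE
  have hEm : Measurable E := Measurable.iSup fun n => (hN n.1 n.2).2.2.2.2.1.ennreal_ofReal
  have hZ : Measurable (regressor s q Y X 0) := measurable_regressor hY hX 0
  -- `toReal` sends `⊤` to `0`, so the real envelope dominates only where the supremum is finite;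
  -- hence the almost sure bound.
  have hfin : ∀ᵐ ω ∂P, E (regressor s q Y X 0 ω) < ⊤ := by
    have hm : Measurable fun ω => E (regressor s q Y X 0 ω) ^ (2 + μ) :=
      (hEm.comp hZ).pow_const _
    filter_upwards [ae_lt_top hm hint.ne] with ω hω
    exact (ENNReal.rpow_lt_top_iff_of_pos (by positivity)).1 hω
  refine ⟨n₀, r₁, r₂, fun z => (E z).toReal, hEm.ennreal_toReal, fun z => ENNReal.toReal_nonneg,
    ?_, fun n hn => ⟨(hN n hn).1, (hN n hn).2.1, (hN n hn).2.2.1, (hN n hn).2.2.2.1⟩, ?_⟩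
  · have hmem : MemLp (fun ω => (E (regressor s q Y X 0 ω)).toReal)
        (ENNReal.ofReal (2 + μ)) P := by
      refine ⟨(hEm.ennreal_toReal.comp hZ).aestronglyMeasurable, ?_⟩
      rw [eLpNorm_lt_top_iff_lintegral_rpow_enorm_lt_top (by simpa using by positivity) (by simp),
        ENNReal.toReal_ofReal (by positivity)]
      refine lt_of_le_of_lt (lintegral_mono fun ω => ?_) hint
      gcongr
      rw [Real.enorm_of_nonneg ENNReal.toReal_nonneg]
      exact ENNReal.ofReal_toReal_le
    refine hmem.mono_exponent ?_
    rw [← ENNReal.ofReal_ofNat]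
    exact ENNReal.ofReal_le_ofReal (by linarith)
  · filter_upwards [hfin] with ω hω n hn
    obtain ⟨-, -, -, -, -, hpos, hb⟩ := hN n hn
    have hle : N n (regressor s q Y X 0 ω) ≤ (E (regressor s q Y X 0 ω)).toReal := by
      rw [← ENNReal.ofReal_le_iff_le_toReal hω.ne]
      exact le_iSup (fun n : {n : ℕ // n₀ ≤ n} =>
        ENNReal.ofReal (N n.1 (regressor s q Y X 0 ω))) ⟨n, hn⟩
    exact ⟨fun ρ hρ θ hθ i => ((hb _).1 ρ hρ θ hθ i).trans hle,
      fun t ht θ hθ j => ((hb _).2 t ht θ hθ j).trans hle⟩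

/-- The zero sequences are admissible, and a ball of nonnegative radius contains its centre. -/
theorem Spec.Dominated.mem_interior (h : M.Dominated P Y X 2 M.Bound₁) :
    M.ρ₀ ∈ interior M.Θ₁ ∧ M.θ₀ ∈ interior M.Θ₂ := by
  obtain ⟨n₀, r₁, r₂, N, μ, -, hN, -⟩ := h (fun _ => 0) (fun _ => 0) ⟨0, by simp⟩
  obtain ⟨h1, h2, h3, h4, -⟩ := hN n₀ le_rfl
  exact ⟨h3 (Metric.mem_closedBall_self ((norm_nonneg _).trans h1)),
    h4 (Metric.mem_closedBall_self ((norm_nonneg _).trans h2))⟩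

variable (hreg : M.Regular)
include hreg

theorem Spec.Regular.differentiableAt_m {ρ : Par ℓ} (hρ : ρ ∈ interior M.Θ₁) (z : Reg s q d) :
    DifferentiableAt ℝ (fun r => M.m r z) ρ :=
  (hreg.diff_m z).differentiableAt (isOpen_interior.mem_nhds hρ)

theorem Spec.Regular.differentiableAt_σ {θ : Par p} (hθ : θ ∈ interior M.Θ₂) (z : Reg s q d) :
    DifferentiableAt ℝ (fun t => M.σ t z) θ :=
  (hreg.diff_σ z).differentiableAt (isOpen_interior.mem_nhds hθ)

/-- The relative first derivatives at the true parameters are square integrable. -/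
theorem Spec.Regular.memLp_relative_partialDeriv [IsFiniteMeasure P] (hY : ∀ i, Measurable (Y i))
    (hX : ∀ i, Measurable (X i)) (h : M.Dominated P Y X 2 M.Bound₁) :
    (∀ j, MemLp (fun ω => partialDeriv (fun r => M.m r (regressor s q Y X 0 ω)) j M.ρ₀ /
      M.σ M.θ₀ (regressor s q Y X 0 ω)) 2 P) ∧
    (∀ k, MemLp (fun ω => partialDeriv (fun t => M.σ t (regressor s q Y X 0 ω)) k M.θ₀ /
      M.σ M.θ₀ (regressor s q Y X 0 ω)) 2 P) := by
  obtain ⟨hρ₀, hθ₀⟩ := h.mem_interior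
  obtain ⟨n₀, r₁, r₂, N, hNm, hN0, hN2, hball, hb⟩ :=
    h.exists_envelope hY hX (u := fun _ => 0) (v := fun _ => 0) ⟨0, by simp⟩
  have hZ : Measurable (regressor s q Y X 0) := measurable_regressor hY hX 0
  have hσ := hreg.meas_σ _ (interior_subset hθ₀)
  have hr₁ : 0 ≤ r₁ n₀ := (norm_nonneg _).trans (hball n₀ le_rfl).1
  have hr₂ : 0 ≤ r₂ n₀ := (norm_nonneg _).trans (hball n₀ le_rfl).2.1
  refine ⟨fun j => hN2.mono ?_ ?_, fun k => hN2.mono ?_ ?_⟩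
  · exact (((measurable_partialDeriv hreg.meas_m hρ₀ (hreg.differentiableAt_m hρ₀) j).div
      hσ).comp hZ).aestronglyMeasurable
  · filter_upwards [hb] with ω hω
    rw [Real.norm_eq_abs, Real.norm_eq_abs, abs_div,
      abs_of_pos (hreg.σ_pos _ (interior_subset hθ₀) _), abs_of_nonneg (hN0 _)]
    exact (hω n₀ le_rfl).1 _ (Metric.mem_closedBall_self hr₁) _ (Metric.mem_closedBall_self hr₂) j
  · exact (((measurable_partialDeriv hreg.meas_σ hθ₀ (hreg.differentiableAt_σ hθ₀) k).div
      hσ).comp hZ).aestronglyMeasurable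
  · filter_upwards [hb] with ω hω
    rw [Real.norm_eq_abs, Real.norm_eq_abs, abs_div,
      abs_of_pos (hreg.σ_pos _ (interior_subset hθ₀) _), abs_of_nonneg (hN0 _)]
    exact (hω n₀ le_rfl).2 _ (Metric.mem_closedBall_self hr₂) _ (Metric.mem_closedBall_self hr₂) k

end Domination

/-- Products of two square integrable functions of the regressor with an integrable function of an
independent innovation. -/
theorem integrable_mul_mul_of_indepFun {α : Type*} [MeasurableSpace α] [MeasurableSpace Ω]
    {P : Measure Ω} {Z : Ω → α} {e : Ω → ℝ} (hind : IndepFun Z e P) {A B : α → ℝ} {g : ℝ → ℝ}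
    (hAm : Measurable A) (hBm : Measurable B) (hgm : Measurable g)
    (hA : MemLp (fun ω => A (Z ω)) 2 P) (hB : MemLp (fun ω => B (Z ω)) 2 P)
    (hg : Integrable (fun ω => g (e ω)) P) :
    Integrable (fun ω => A (Z ω) * B (Z ω) * g (e ω)) P :=
  -- Cauchy–Schwarz makes `A * B` integrable, and independence allows multiplication by an
  -- integrable function of `e` without further moments.
  (hind.comp (φ := fun z => A z * B z) (hAm.mul hBm) hgm).integrable_mul
    (hA.integrable_mul hB) hg

/-! ### Expectations of the derivative terms. -/

section Terms

variable [MeasurableSpace Ω] {M : Spec s q d ℓ p} {P : Measure Ω}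
  {Y : ℤ → Ω → ℝ} {X : ℤ → Ω → Fin d → ℝ} {ε : ℤ → Ω → ℝ} {g : ℝ → ℝ} {H : Reg s q d → ℝ}

theorem measurable_relative_partialDeriv_m (hreg : M.Regular) (hρ₀ : M.ρ₀ ∈ interior M.Θ₁)
    (hθ₀ : M.θ₀ ∈ M.Θ₂) (j : Fin ℓ) :
    Measurable fun z => partialDeriv (fun r => M.m r z) j M.ρ₀ / M.σ M.θ₀ z :=
  (measurable_partialDeriv hreg.meas_m hρ₀ (hreg.differentiableAt_m hρ₀) j).div
    (hreg.meas_σ _ hθ₀)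

theorem measurable_relative_partialDeriv_σ (hreg : M.Regular) (hθ₀ : M.θ₀ ∈ interior M.Θ₂)
    (k : Fin p) :
    Measurable fun z => partialDeriv (fun t => M.σ t z) k M.θ₀ / M.σ M.θ₀ z :=
  (measurable_partialDeriv hreg.meas_σ hθ₀ (hreg.differentiableAt_σ hθ₀) k).div
    (hreg.meas_σ _ (interior_subset hθ₀))

variable [IsFiniteMeasure P] (hreg : M.Regular) (hY : ∀ i, Measurable (Y i))
  (hX : ∀ i, Measurable (X i)) (hdom : M.Dominated P Y X 2 M.Bound₁)
  (hind : IndepFun (regressor s q Y X 0) (ε 0) P) (hH : Measurable H)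
  (hH2 : MemLp (fun ω => H (regressor s q Y X 0 ω) / M.σ M.θ₀ (regressor s q Y X 0 ω)) 2 P)

include hreg hY hX hdom hind hH hH2

theorem integrable_meanTerm (hgm : Measurable g) (hg : Integrable (fun ω => g (ε 0 ω)) P)
    (j : Fin ℓ) : Integrable (M.meanTerm Y X ε g H j) P := by
  obtain ⟨hρ₀, hθ₀⟩ := hdom.mem_interior
  refine (integrable_mul_mul_of_indepFun hind
    (measurable_relative_partialDeriv_m hreg hρ₀ (interior_subset hθ₀) j)
    (hH.div (hreg.meas_σ _ (interior_subset hθ₀))) hgm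
    ((hreg.memLp_relative_partialDeriv hY hX hdom).1 j) hH2 hg).congr
    (Eventually.of_forall fun ω => ?_)
  simp only [Spec.meanTerm, Pi.div_apply]
  ring

theorem integrable_scaleTerm (hgm : Measurable g) (hg : Integrable (fun ω => ε 0 ω * g (ε 0 ω)) P)
    (k : Fin p) : Integrable (M.scaleTerm Y X ε g H k) P := by
  obtain ⟨hρ₀, hθ₀⟩ := hdom.mem_interior
  refine (integrable_mul_mul_of_indepFun (g := fun x => x * g x) hind
    (measurable_relative_partialDeriv_σ hreg hθ₀ k)
    (hH.div (hreg.meas_σ _ (interior_subset hθ₀))) (measurable_id.mul hgm)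
    ((hreg.memLp_relative_partialDeriv hY hX hdom).2 k) hH2 hg).congr
    (Eventually.of_forall fun ω => ?_)
  simp only [Spec.scaleTerm, Pi.div_apply]
  ring

theorem integrable_noiseTerm (hgm : Measurable g) (hg : Integrable (fun ω => g (ε 0 ω)) P)
    (k : Fin p) : Integrable (M.noiseTerm Y X ε g H k) P := by
  obtain ⟨hρ₀, hθ₀⟩ := hdom.mem_interior
  refine (integrable_mul_mul_of_indepFun hind
    (measurable_relative_partialDeriv_σ hreg hθ₀ k)
    (hH.div (hreg.meas_σ _ (interior_subset hθ₀))) hgm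
    ((hreg.memLp_relative_partialDeriv hY hX hdom).2 k) hH2 hg).congr
    (Eventually.of_forall fun ω => ?_)
  simp only [Spec.noiseTerm, Pi.div_apply]
  ring

/-- Independence factors the expectation, and one factor is the mean of `g(ε₀)`. Hence
differentiating the weight `H/σ` contributes nothing to the limit. -/
theorem integral_noiseTerm (hgm : Measurable g) (hg : Integrable (fun ω => g (ε 0 ω)) P)
    (hg0 : ∫ ω, g (ε 0 ω) ∂P = 0) (k : Fin p) : ∫ ω, M.noiseTerm Y X ε g H k ω ∂P = 0 := by
  obtain ⟨hρ₀, hθ₀⟩ := hdom.mem_interior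
  have hA := (hreg.memLp_relative_partialDeriv hY hX hdom).2 k
  have hi := hind.comp (φ := fun z => partialDeriv (fun t => M.σ t z) k M.θ₀ / M.σ M.θ₀ z *
    (H z / M.σ M.θ₀ z)) (ψ := g) ((measurable_relative_partialDeriv_σ hreg hθ₀ k).mul
    (hH.div (hreg.meas_σ _ (interior_subset hθ₀)))) hgm
  have := hi.integral_fun_mul_eq_mul_integral (hA.integrable_mul hH2).aestronglyMeasurable
    hg.aestronglyMeasurable
  simp only [Function.comp_apply, hg0, mul_zero] at this
  rw [← this]
  refine integral_congr_ae (Eventually.of_forall fun ω => ?_)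
  simp only [Spec.noiseTerm]
  ring

end Terms

/-- On the path space the residual at the true parameters plays the role of the innovation, so the
model equation holds at every path. -/
theorem Spec.Regular.coordY_zero_eq {M : Spec s q d ℓ p} (hreg : M.Regular) (hθ₀ : M.θ₀ ∈ M.Θ₂)
    (w : ℤ → ℝ × (Fin d → ℝ)) :
    coordY 0 w = M.m M.ρ₀ (regressor s q coordY coordX 0 w) +
      M.σ M.θ₀ (regressor s q coordY coordX 0 w) * M.residual coordY coordX M.ρ₀ M.θ₀ 0 w := by
  have := (hreg.σ_pos _ hθ₀ (regressor s q coordY coordX 0 w)).ne'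
  simp only [Spec.residual]
  field_simp
  ring

theorem linForm_add_smul {k n : ℕ} (hn : 1 ≤ n) (a u : Par k) (c : Fin k → ℝ) :
    linForm n (a + (√(n : ℝ))⁻¹ • u) a c = ∑ j, u j * c j := by
  have hs : √(n : ℝ) ≠ 0 := by positivity
  simp [linForm, hs]

theorem _root_.MeasureTheory.MemLp.integrable_one_add_abs_sq [MeasurableSpace Ω] {P : Measure Ω}
    [IsFiniteMeasure P] {e : Ω → ℝ} (he : MemLp e 2 P) :
    Integrable (fun w => (1 + |e w|) ^ 2) P :=
  ((memLp_const (1 : ℝ)).add he.norm).integrable_sq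

set_option maxHeartbeats 800000 in
/-- Asymptotic linearity along deterministic local sequences. -/
theorem Spec.Regular.tendstoInMeasure_stat_sub {M : Spec s q d ℓ p} (hreg : M.Regular)
    {π : Measure (ℤ → ℝ × (Fin d → ℝ))} [IsProbabilityMeasure π] (hT : Ergodic shift π)
    (hdom : M.Dominated π coordY coordX 2 M.Bound₁)
    (hind : IndepFun (regressor s q coordY coordX 0) (M.residual coordY coordX M.ρ₀ M.θ₀ 0) π)
    (he2 : MemLp (M.residual coordY coordX M.ρ₀ M.θ₀ 0) 2 π)
    {H : Reg s q d → ℝ} (hH : Measurable H)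
    (hH2 : MemLp (fun w => H (regressor s q coordY coordX 0 w) /
      M.σ M.θ₀ (regressor s q coordY coordX 0 w)) 2 π)
    {g : ℝ → ℝ} (hg : Differentiable ℝ g) (hg' : Differentiable ℝ (deriv g))
    (hg'' : ∃ C : ℝ, ∀ x, |deriv (deriv g) x| ≤ C)
    (hg0 : ∫ w, g (M.residual coordY coordX M.ρ₀ M.θ₀ 0 w) ∂π = 0) (h : ℝ)
    {u : ℕ → Par ℓ} {v : ℕ → Par p} (huv : ∃ C : ℝ, ∀ n, ‖u n‖ ^ 2 + ‖v n‖ ^ 2 ≤ C) :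
    TendstoInMeasure π (fun (n : ℕ) w =>
      (M.stat coordY coordX g H h n (M.ρ₀ + (√(n : ℝ))⁻¹ • u n) (M.θ₀ + (√(n : ℝ))⁻¹ • v n) w -
        M.stat coordY coordX g H h n M.ρ₀ M.θ₀ w) -
      (linForm n (M.ρ₀ + (√(n : ℝ))⁻¹ • u n) M.ρ₀ (fun j => h * ∫ w', M.meanTerm coordY coordX
          (M.residual coordY coordX M.ρ₀ M.θ₀) (deriv g) H j w' ∂π) +
        linForm n (M.θ₀ + (√(n : ℝ))⁻¹ • v n) M.θ₀ (fun k => h * ∫ w', M.scaleTerm coordY coordX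
          (M.residual coordY coordX M.ρ₀ M.θ₀) (deriv g) H k w' ∂π)))
      atTop (fun _ => 0) := by
  obtain ⟨hρ₀, hθ₀⟩ := hdom.mem_interior
  have hθ₀' := interior_subset hθ₀
  obtain ⟨n₀, r₁, r₂, N, hNm, hN0, hN2, hball, hb⟩ :=
    hdom.exists_envelope measurable_coordY measurable_coordX huv
  obtain ⟨C, hC⟩ := huv
  set Z : (ℤ → ℝ × (Fin d → ℝ)) → Reg s q d := regressor s q coordY coordX 0 with hZdef
  set e : (ℤ → ℝ × (Fin d → ℝ)) → ℝ := M.residual coordY coordX M.ρ₀ M.θ₀ 0 with hedef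
  have hZ : Measurable Z := measurable_regressor measurable_coordY measurable_coordX 0
  have hem : Measurable e := hreg.measurable_residual measurable_coordY measurable_coordX
    (interior_subset hρ₀) hθ₀' 0
  set D := √C with hD
  have huD : ∀ n, ‖u n‖ ≤ D := fun n =>
    Real.le_sqrt_of_sq_le (le_trans (by nlinarith [sq_nonneg ‖v n‖]) (hC n))
  have hvD : ∀ n, ‖v n‖ ≤ D := fun n =>
    Real.le_sqrt_of_sq_le (le_trans (by nlinarith [sq_nonneg ‖u n‖]) (hC n))
  have hD0 : 0 ≤ D := Real.sqrt_nonneg _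
  obtain ⟨c, hc0, hcg', hcg, hclip⟩ := exists_growth_of_deriv_deriv_bounded hg hg' hg''
  have hgm : Measurable g := hg.continuous.measurable
  have hgm' : Measurable (deriv g) := hg'.continuous.measurable
  -- integrability of functions of the innovation
  have hq : Integrable (fun w => (1 + |e w|) ^ 2) π := he2.integrable_one_add_abs_sq
  have hgi : Integrable (fun w => g (e w)) π :=
    (hq.const_mul c).mono' (hgm.comp hem).aestronglyMeasurable
      (Eventually.of_forall fun w => hcg (e w))
  have hgi' : Integrable (fun w => deriv g (e w)) π :=
    (hq.const_mul c).mono' (hgm'.comp hem).aestronglyMeasurable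
      (Eventually.of_forall fun w => (hcg' (e w)).trans (by
        gcongr; nlinarith [abs_nonneg (e w)]))
  have hgie : Integrable (fun w => e w * deriv g (e w)) π :=
    (hq.const_mul c).mono' (hem.mul (hgm'.comp hem)).aestronglyMeasurable
      (Eventually.of_forall fun w => by
        rw [Real.norm_eq_abs, abs_mul]
        nlinarith [abs_nonneg (e w), hcg' (e w), mul_nonneg hc0 (abs_nonneg (e w)),
          mul_le_mul_of_nonneg_left (hcg' (e w)) (abs_nonneg (e w))])
  have hA := fun j => integrable_meanTerm (ε := M.residual coordY coordX M.ρ₀ M.θ₀) hreg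
    measurable_coordY measurable_coordX hdom hind hH hH2 hgm' hgi' j
  have hB := fun k => integrable_scaleTerm (ε := M.residual coordY coordX M.ρ₀ M.θ₀) hreg
    measurable_coordY measurable_coordX hdom hind hH hH2 hgm' hgie k
  have hE := fun k => integrable_noiseTerm (ε := M.residual coordY coordX M.ρ₀ M.θ₀) hreg
    measurable_coordY measurable_coordX hdom hind hH hH2 hgm hgi k
  have hE0 := fun k => integral_noiseTerm (ε := M.residual coordY coordX M.ρ₀ M.θ₀) hreg
    measurable_coordY measurable_coordX hdom hind hH hH2 hgm hgi hg0 k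
  -- `A` and `B` are the coefficients of the derivative of one summand; their minus signs cancel the
  -- one in front of the statistic.
  set A : Fin ℓ → (ℤ → ℝ × (Fin d → ℝ)) → ℝ := fun j w => -M.meanTerm coordY coordX
    (M.residual coordY coordX M.ρ₀ M.θ₀) (deriv g) H j w with hAdef
  set B : Fin p → (ℤ → ℝ × (Fin d → ℝ)) → ℝ := fun k w => -(M.scaleTerm coordY coordX
    (M.residual coordY coordX M.ρ₀ M.θ₀) (deriv g) H k w + M.noiseTerm coordY coordX
    (M.residual coordY coordX M.ρ₀ M.θ₀) g H k w) with hBdef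
  have hAi : ∀ j, Integrable (A j) π := fun j => (hA j).neg
  have hBi : ∀ k, Integrable (B k) π := fun k => ((hB k).add (hE k)).neg
  set Φ : ℕ → (ℤ → ℝ × (Fin d → ℝ)) → ℝ := fun n w => √(n : ℝ) *
    (g (M.residual coordY coordX (M.ρ₀ + (√(n : ℝ))⁻¹ • u n) (M.θ₀ + (√(n : ℝ))⁻¹ • v n) 0 w) *
      (H (Z w) / M.σ (M.θ₀ + (√(n : ℝ))⁻¹ • v n) (Z w)) -
      g (e w) * (H (Z w) / M.σ M.θ₀ (Z w))) with hΦ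
  set Λ : ℕ → (ℤ → ℝ × (Fin d → ℝ)) → ℝ := fun n w =>
    ∑ j, u n j * A j w + ∑ k, v n k * B k w with hΛ
  have hmemρ : ∀ n, n₀ ≤ n → M.ρ₀ + (√(n : ℝ))⁻¹ • u n ∈ Metric.closedBall M.ρ₀ (r₁ n) :=
    fun n hn => by simpa [dist_eq_norm] using (hball n hn).1
  have hmemθ : ∀ n, n₀ ≤ n → M.θ₀ + (√(n : ℝ))⁻¹ • v n ∈ Metric.closedBall M.θ₀ (r₂ n) :=
    fun n hn => by simpa [dist_eq_norm] using (hball n hn).2.1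
  -- the pointwise limit
  have hpt : ∀ w, Tendsto (fun n => Φ n w - Λ n w) atTop (𝓝 0) := by
    intro w
    obtain ⟨L, hL, hLv⟩ := exists_hasFDerivAt_summand (m := fun r => M.m r (Z w))
      (σ := fun t => M.σ t (Z w)) (g := g) (a := M.ρ₀) (b := M.θ₀) (e := e w) (y := coordY 0 w)
      (H := H (Z w)) (hreg.differentiableAt_m hρ₀ _) (hreg.differentiableAt_σ hθ₀ _)
      (hreg.σ_pos _ hθ₀' _).ne' rfl (hg _)
    refine (tendsto_sqrt_mul_sub_sub hL (w := fun n => (u n, v n)) (C := D) fun n =>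
      max_le (huD n) (hvD n)).congr fun n => ?_
    rw [hLv, fderiv_eq_sum_partialDeriv, fderiv_eq_sum_partialDeriv]
    simp only [hΦ, hΛ, hAdef, hBdef, Spec.meanTerm, Spec.scaleTerm, Spec.noiseTerm, Prod.mk_add_mk,
      Prod.smul_mk]
    congr 1
    rw [sub_eq_add_neg, Finset.sum_div, Finset.sum_div, Finset.sum_mul, Finset.sum_mul,
      ← Finset.sum_neg_distrib, ← Finset.sum_neg_distrib]
    congr 1
    · refine Finset.sum_congr rfl fun j _ => ?_
      simp only [← hZdef, ← hedef]
      ring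
    · refine Finset.sum_congr rfl fun j _ => ?_
      simp only [← hZdef, ← hedef]
      ring
  -- domination
  set κ : ℝ := (ℓ + p) * D with hκ
  have hκ0 : 0 ≤ κ := by positivity
  set K : ℝ := c * κ * ((2 + κ) * (1 + κ) + 1) with hK
  set bound : (ℤ → ℝ × (Fin d → ℝ)) → ℝ := fun w =>
    K * (N (Z w) * |H (Z w) / M.σ M.θ₀ (Z w)| * (1 + |e w|) ^ 2) +
      (∑ j, D * |A j w| + ∑ k, D * |B k w|) with hbound
  -- `N(Z)` and `H/σ` are square integrable and independent of `e`, so only the second moment of `e`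
  -- is needed.
  have hbi : Integrable bound π := by
    refine Integrable.add (Integrable.const_mul ?_ K) (Integrable.add
      (integrable_finsetSum _ fun j _ => (hAi j).abs.const_mul D)
      (integrable_finsetSum _ fun k _ => (hBi k).abs.const_mul D))
    exact integrable_mul_mul_of_indepFun (B := fun z => |H z / M.σ M.θ₀ z|)
      (g := fun x => (1 + |x|) ^ 2) hind hNm (hH.div (hreg.meas_σ _ hθ₀')).abs
      (by fun_prop) hN2 hH2.norm hq
  have hΛi : ∀ n, Integrable (Λ n) π := fun n => Integrable.add
    (integrable_finsetSum _ fun j _ => (hAi j).const_mul _)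
    (integrable_finsetSum _ fun k _ => (hBi k).const_mul _)
  have hset : ∀ n : ℕ, MeasurableSet {w | N (Z w) ≤ √(n : ℝ)} := fun n =>
    measurableSet_le (hNm.comp hZ) measurable_const
  have hmeas : ∀ n, n₀ ≤ n → AEStronglyMeasurable
      ({w | N (Z w) ≤ √(n : ℝ)}.indicator (fun w => Φ n w - Λ n w)) π := by
    intro n hn
    refine AEStronglyMeasurable.indicator (AEStronglyMeasurable.sub ?_ (hΛi n).aestronglyMeasurable)
      (hset n)
    have hρn := interior_subset ((hball n hn).2.2.1 (hmemρ n hn))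
    have hθn := interior_subset ((hball n hn).2.2.2 (hmemθ n hn))
    refine Measurable.aestronglyMeasurable (Measurable.const_mul (Measurable.sub ?_ ?_) _)
    · exact (hgm.comp (hreg.measurable_residual measurable_coordY measurable_coordX hρn hθn 0)).mul
        ((hH.comp hZ).div ((hreg.meas_σ _ hθn).comp hZ))
    · exact (hgm.comp hem).mul ((hH.comp hZ).div ((hreg.meas_σ _ hθ₀').comp hZ))
  have hdomin : ∀ n, max n₀ 1 ≤ n → ∀ᵐ w ∂π,
      |{w | N (Z w) ≤ √(n : ℝ)}.indicator (fun w => Φ n w - Λ n w) w| ≤ bound w := by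
    intro n hn
    obtain ⟨hn₀, hn1⟩ := max_le_iff.1 hn
    have hs : 0 < √(n : ℝ) := by positivity
    filter_upwards [hb] with w hw
    have hbw : 0 ≤ bound w := by
      have := hN0 (Z w)
      simp only [hbound]
      positivity
    by_cases hmem : w ∈ {w | N (Z w) ≤ √(n : ℝ)}
    swap
    · rw [Set.indicator_of_notMem hmem, abs_zero]; exact hbw
    rw [Set.indicator_of_mem hmem]
    rw [Set.mem_ofPred_eq] at hmem
    obtain ⟨hw1, hw2⟩ := hw n hn₀
    have hρn := (hball n hn₀).2.2.1 (hmemρ n hn₀)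
    have hθn := (hball n hn₀).2.2.2 (hmemθ n hn₀)
    have hσ₁ := hreg.σ_pos _ (interior_subset hθn) (Z w)
    have hσ₀ := hreg.σ_pos _ hθ₀' (Z w)
    have hNσ : 0 ≤ N (Z w) * M.σ (M.θ₀ + (√(n : ℝ))⁻¹ • v n) (Z w) :=
      mul_nonneg (hN0 _) hσ₁.le
    have hstep : ∀ (k : ℕ) (x : ℝ), (k : ℝ) ≤ ℓ + p → x ≤ D →
        0 ≤ x → k * (N (Z w) * M.σ (M.θ₀ + (√(n : ℝ))⁻¹ • v n) (Z w)) * ((√(n : ℝ))⁻¹ * x) ≤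
          κ * ((√(n : ℝ))⁻¹ * N (Z w)) * M.σ (M.θ₀ + (√(n : ℝ))⁻¹ • v n) (Z w) := by
      intro k x hk hx hx0
      calc k * (N (Z w) * M.σ (M.θ₀ + (√(n : ℝ))⁻¹ • v n) (Z w)) * ((√(n : ℝ))⁻¹ * x)
          ≤ (ℓ + p) * (N (Z w) * M.σ (M.θ₀ + (√(n : ℝ))⁻¹ • v n) (Z w)) * ((√(n : ℝ))⁻¹ * D) := by
            gcongr
        _ = _ := by rw [hκ]; ring
    have hm : |M.m (M.ρ₀ + (√(n : ℝ))⁻¹ • u n) (Z w) - M.m M.ρ₀ (Z w)| ≤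
        κ * ((√(n : ℝ))⁻¹ * N (Z w)) * M.σ (M.θ₀ + (√(n : ℝ))⁻¹ • v n) (Z w) := by
      have := abs_sub_le_of_partialDeriv_le (g := fun r => M.m r (Z w)) hNσ
        (fun y hy => hreg.differentiableAt_m ((hball n hn₀).2.2.1 hy) (Z w))
        -- The domination condition allows different parameters in numerator and denominator, so the
        -- bound is taken relative to the perturbed scale.
        (fun y hy j => (div_le_iff₀ hσ₁).1 (hw1 y hy _ (hmemθ n hn₀) j))
        (x := M.ρ₀ + (√(n : ℝ))⁻¹ • u n) (by simpa using (hball n hn₀).1)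
      rw [add_sub_cancel_left, norm_smul, Real.norm_of_nonneg (by positivity)] at this
      exact this.trans (hstep ℓ _ (by simp) (huD n) (norm_nonneg _))
    have hsg : |M.σ (M.θ₀ + (√(n : ℝ))⁻¹ • v n) (Z w) - M.σ M.θ₀ (Z w)| ≤
        κ * ((√(n : ℝ))⁻¹ * N (Z w)) * M.σ (M.θ₀ + (√(n : ℝ))⁻¹ • v n) (Z w) := by
      have := abs_sub_le_of_partialDeriv_le (g := fun t => M.σ t (Z w)) hNσ
        (fun y hy => hreg.differentiableAt_σ ((hball n hn₀).2.2.2 hy) (Z w))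
        (fun y hy j => (div_le_iff₀ hσ₁).1 (hw2 y hy _ (hmemθ n hn₀) j))
        (x := M.θ₀ + (√(n : ℝ))⁻¹ • v n) (by simpa using (hball n hn₀).2.1)
      rw [add_sub_cancel_left, norm_smul, Real.norm_of_nonneg (by positivity)] at this
      exact this.trans (hstep p _ (by simp) (hvD n) (norm_nonneg _))
    -- Here the truncation `N ≤ √n` is used: the relative perturbation stays bounded, so the
    -- quadratic growth of `g` is harmless.
    have hη1 : (√(n : ℝ))⁻¹ * N (Z w) ≤ 1 := by
      rw [inv_mul_le_iff₀ hs, mul_one]; exact hmem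
    have hmain := abs_summand_sub_le (e := e w) (H := H (Z w)) hc0 hcg hclip hκ0
      (mul_nonneg (by positivity) (hN0 (Z w))) hη1 hσ₀ hσ₁ hm hsg
    rw [← hreg.coordY_zero_eq hθ₀' w] at hmain
    have hΦb : |Φ n w| ≤ K * (N (Z w) * |H (Z w) / M.σ M.θ₀ (Z w)| * (1 + |e w|) ^ 2) := by
      rw [hΦ]
      simp only
      rw [abs_mul, abs_of_pos hs]
      refine (mul_le_mul_of_nonneg_left hmain hs.le).trans (le_of_eq ?_)
      rw [hK]
      field_simp
    have hΛb : |Λ n w| ≤ ∑ j, D * |A j w| + ∑ k, D * |B k w| := by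
      refine (abs_add_le _ _).trans (add_le_add ?_ ?_)
      · refine (Finset.abs_sum_le_sum_abs _ _).trans (Finset.sum_le_sum fun j _ => ?_)
        rw [abs_mul]
        gcongr
        exact (PiLp.norm_apply_le (u n) j).trans (huD n)
      · refine (Finset.abs_sum_le_sum_abs _ _).trans (Finset.sum_le_sum fun j _ => ?_)
        rw [abs_mul]
        gcongr
        exact (PiLp.norm_apply_le (v n) j).trans (hvD n)
    exact (abs_sub _ _).trans (add_le_add hΦb hΛb)
  have hrem : TendstoInMeasure π
      (fun n w => orbitAverage shift (fun w => Φ n w - Λ n w) n w) atTop (fun _ => 0) := by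
    refine hT.toMeasurePreserving.tendstoInMeasure_orbitAverage_zero (N := fun w => N (Z w))
      (F := fun n w => Φ n w - Λ n w) (hNm.comp hZ) hN2 ?_ ?_
    · filter_upwards [eventually_ge_atTop (max n₀ 1)] with n hn
      exact hbi.mono' (hmeas n ((le_max_left _ _).trans hn)) (hdomin n hn)
    · rw [show (0 : ℝ) = ∫ _, (0 : ℝ) ∂π by simp]
      refine tendsto_integral_filter_of_dominated_convergence bound ?_ ?_ hbi ?_
      · filter_upwards [eventually_ge_atTop n₀] with n hn
        exact (hmeas n hn).norm
      · filter_upwards [eventually_ge_atTop (max n₀ 1)] with n hn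
        simpa only [Real.norm_eq_abs, abs_abs] using hdomin n hn
      · filter_upwards with w
        refine squeeze_zero (fun n => abs_nonneg _) (fun n => ?_)
          (tendsto_zero_iff_abs_tendsto_zero _ |>.1 (hpt w))
        exact norm_indicator_le_norm_self (fun w => Φ n w - Λ n w) w
  -- The ergodic theorem applies to each fixed `A j`; the varying coefficients only need to be
  -- bounded.
  have hlinA : TendstoInMeasure π (fun n w => ∑ j, u n j *
      (orbitAverage shift (A j) n w - ∫ w', A j w' ∂π)) atTop (fun _ => 0) :=
    TendstoInMeasure.zero_sum _ fun j _ =>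
      (hT.tendstoInMeasure_orbitAverage (hAi j)).zero_of_abs_le_mul (C := D)
        (Eventually.of_forall fun n w => by
          rw [abs_mul]
          gcongr
          exact (PiLp.norm_apply_le (u n) j).trans (huD n))
  have hlinB : TendstoInMeasure π (fun n w => ∑ k, v n k *
      (orbitAverage shift (B k) n w - ∫ w', B k w' ∂π)) atTop (fun _ => 0) :=
    TendstoInMeasure.zero_sum _ fun k _ =>
      (hT.tendstoInMeasure_orbitAverage (hBi k)).zero_of_abs_le_mul (C := D)
        (Eventually.of_forall fun n w => by
          rw [abs_mul]
          gcongr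
          exact (PiLp.norm_apply_le (v n) k).trans (hvD n))
  -- For `n ≥ 1` the error of the expansion equals, up to sign, `h` times the sum of these three
  -- terms.
  refine ((hrem.zero_add hlinA).zero_add hlinB).zero_of_abs_le_mul (C := |h|) ?_
  filter_upwards [eventually_ge_atTop 1] with n hn w
  rw [← abs_mul, M.stat_sub_eq_orbitAverage g H h hn, linForm_add_smul hn, linForm_add_smul hn,
    ← abs_neg]
  refine le_of_eq (congrArg _ ?_)
  have hΦΛ : orbitAverage shift (Φ n) n w = orbitAverage shift (fun w => Φ n w - Λ n w) n w +
      (∑ j, u n j * orbitAverage shift (A j) n w + ∑ k, v n k * orbitAverage shift (B k) n w) := by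
    simp only [← orbitAverage_const_mul]
    rw [← orbitAverage_sum, ← orbitAverage_sum, ← orbitAverage_add, ← orbitAverage_add]
    simp [hΛ]
  have hAint : ∀ j, ∫ w', A j w' ∂π = -∫ w', M.meanTerm coordY coordX
      (M.residual coordY coordX M.ρ₀ M.θ₀) (deriv g) H j w' ∂π := fun j => integral_neg _
  have hBint : ∀ k, ∫ w', B k w' ∂π = -∫ w', M.scaleTerm coordY coordX
      (M.residual coordY coordX M.ρ₀ M.θ₀) (deriv g) H k w' ∂π := fun k => by
    rw [hBdef]
    simp only
    rw [integral_neg, integral_add (hB k) (hE k), hE0, add_zero]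
  show -(-h * orbitAverage shift (Φ n) n w - _) = _
  rw [hΦΛ]
  simp only [hAint, hBint, mul_sub, mul_neg, Finset.sum_sub_distrib, Finset.sum_neg_distrib,
    mul_left_comm _ h, ← Finset.mul_sum]
  ring

theorem HasMoment.memLp_two [MeasurableSpace Ω] {P : Measure Ω} [IsFiniteMeasure P] {U : Ω → ℝ}
    {a : ℝ} (hU : HasMoment P U a) (hm : AEStronglyMeasurable U P) (ha : 2 ≤ a) : MemLp U 2 P := by
  have h : MemLp U (ENNReal.ofReal a) P := by
    rw [← integrable_norm_rpow_iff hm (by simpa using by linarith) (by simp),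
      ENNReal.toReal_ofReal (by linarith)]
    exact hU
  refine h.mono_exponent ?_
  rw [← ENNReal.ofReal_ofNat]
  exact ENNReal.ofReal_le_ofReal ha

theorem linForm_add {k : ℕ} (n : ℕ) (x a : Par k) (c c' : Fin k → ℝ) :
    linForm n x a (fun j => c j + c' j) = linForm n x a c + linForm n x a c' := by
  simp [linForm, mul_add, Finset.sum_add_distrib]

theorem stat_path (M : Spec s q d ℓ p) (Y : ℤ → Ω → ℝ) (X : ℤ → Ω → Fin d → ℝ) (g : ℝ → ℝ)
    (H : Reg s q d → ℝ) (h : ℝ) (n : ℕ) (ρ : Par ℓ) (θ : Par p) (ω : Ω) :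
    M.stat coordY coordX g H h n ρ θ (fun i => (Y i ω, X i ω)) = M.stat Y X g H h n ρ θ ω := rfl

/-! ### Transfer from the model to its path law. -/

section Null

variable [MeasurableSpace Ω] {M : Spec s q d ℓ p} {P : Measure Ω}
  {Y : ℤ → Ω → ℝ} {X : ℤ → Ω → Fin d → ℝ} {ε : ℤ → Ω → ℝ}

theorem Spec.Null.residual_ae_eq (hnull : M.Null P Y X ε) (hreg : M.Regular) :
    M.residual Y X M.ρ₀ M.θ₀ 0 =ᵐ[P] ε 0 := by
  filter_upwards [hnull.model 0] with ω hω
  have := (hreg.σ_pos _ hnull.θ₀_mem (regressor s q Y X 0 ω)).ne'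
  rw [Spec.residual, hω]
  field_simp
  ring

theorem Spec.Null.indepFun_regressor (hnull : M.Null P Y X ε) :
    IndepFun (regressor s q Y X 0) (ε 0) P := by
  have h := indep_of_indep_of_le_right (hnull.indep_past 0)
    (le_iSup (fun j : {j : ℤ // j ≤ 0} => MeasurableSpace.comap (regressor s q Y X j.1)
      inferInstance) ⟨0, le_rfl⟩)
  exact h.symm

/-- The Bochner integral of a nonintegrable function is `0`, so a variance equal to `1` forces
integrability. -/
theorem Spec.Null.memLp_innovation (hnull : M.Null P Y X ε) : MemLp (ε 0) 2 P := by
  rw [memLp_two_iff_integrable_sq (hnull.meas_ε 0).aestronglyMeasurable]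
  by_contra h
  have := hnull.unit_variance
  rw [integral_undef h] at this
  norm_num at this

variable [IsProbabilityMeasure P]

/-- Asymptotic linearity of the statistic at discretized root-`n` consistent estimators. -/
theorem Spec.Null.tendstoInMeasure_stat_estimator (hnull : M.Null P Y X ε) (hreg : M.Regular)
    (hdom : M.Dominated P Y X 2 M.Bound₁) {H : Reg s q d → ℝ} (hH : Measurable H)
    (hH2 : MemLp (fun ω => H (regressor s q Y X 0 ω) / M.σ M.θ₀ (regressor s q Y X 0 ω)) 2 P)
    {g : ℝ → ℝ} (hg : Differentiable ℝ g) (hg' : Differentiable ℝ (deriv g))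
    (hg'' : ∃ C : ℝ, ∀ x, |deriv (deriv g) x| ≤ C) (hg0 : ∫ ω, g (ε 0 ω) ∂P = 0) (h : ℝ)
    {ρhat : ℕ → Ω → Par ℓ} {θhat : ℕ → Ω → Par p}
    (hρcons : RootNConsistent P ρhat M.ρ₀) (hθcons : RootNConsistent P θhat M.θ₀)
    (hρdisc : LocallyDiscrete ρhat M.ρ₀) (hθdisc : LocallyDiscrete θhat M.θ₀) :
    (∀ j, Integrable (M.meanTerm Y X ε (deriv g) H j) P) ∧
    (∀ k, Integrable (M.scaleTerm Y X ε (deriv g) H k) P) ∧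
    TendstoInMeasure P (fun (n : ℕ) ω =>
      (M.stat Y X g H h n (ρhat n ω) (θhat n ω) ω - M.stat Y X g H h n M.ρ₀ M.θ₀ ω) -
        (linForm n (ρhat n ω) M.ρ₀ (fun j => h * ∫ ω', M.meanTerm Y X ε (deriv g) H j ω' ∂P) +
          linForm n (θhat n ω) M.θ₀
            (fun k => h * ∫ ω', M.scaleTerm Y X ε (deriv g) H k ω' ∂P)))
      atTop (fun _ => 0) := by
  have hY := hnull.meas_Y
  have hX := hnull.meas_X
  have hind := hnull.indepFun_regressor
  have hgm : Measurable g := hg.continuous.measurable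
  have hgm' : Measurable (deriv g) := hg'.continuous.measurable
  have hρ₀ := hnull.ρ₀_mem
  have hθ₀ := hnull.θ₀_mem
  obtain ⟨c, hc0, hcg', -, -⟩ := exists_growth_of_deriv_deriv_bounded hg hg' hg''
  have hq := hnull.memLp_innovation.integrable_one_add_abs_sq
  have hεm := hnull.meas_ε 0
  have hgi' : Integrable (fun ω => deriv g (ε 0 ω)) P :=
    (hq.const_mul c).mono' (hgm'.comp hεm).aestronglyMeasurable
      (Eventually.of_forall fun ω => (hcg' (ε 0 ω)).trans (by
        gcongr; nlinarith [abs_nonneg (ε 0 ω)]))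
  have hgie : Integrable (fun ω => ε 0 ω * deriv g (ε 0 ω)) P :=
    (hq.const_mul c).mono' (hεm.mul (hgm'.comp hεm)).aestronglyMeasurable
      (Eventually.of_forall fun ω => by
        rw [Real.norm_eq_abs, abs_mul]
        nlinarith [abs_nonneg (ε 0 ω), hcg' (ε 0 ω), mul_nonneg hc0 (abs_nonneg (ε 0 ω)),
          mul_le_mul_of_nonneg_left (hcg' (ε 0 ω)) (abs_nonneg (ε 0 ω))])
  refine ⟨fun j => integrable_meanTerm hreg hY hX hdom hind hH hH2 hgm' hgi' j,
    fun k => integrable_scaleTerm hreg hY hX hdom hind hH hH2 hgm' hgie k, ?_⟩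
  set path : Ω → ℤ → ℝ × (Fin d → ℝ) := fun ω i => (Y i ω, X i ω) with hpath
  have hpm : Measurable path := measurable_pi_lambda _ fun i => (hY i).prodMk (hX i)
  obtain ⟨π, hπ⟩ : ∃ π, π = P.map path := ⟨_, rfl⟩
  have : IsProbabilityMeasure π := hπ ▸ Measure.isProbabilityMeasure_map hpm.aemeasurable
  have hZm : Measurable (regressor s q (coordY (d := d)) coordX 0) :=
    measurable_regressor measurable_coordY measurable_coordX 0
  have hem : Measurable (M.residual (coordY (d := d)) coordX M.ρ₀ M.θ₀ 0) :=
    hreg.measurable_residual measurable_coordY measurable_coordX hρ₀ hθ₀ 0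
  have hres := hnull.residual_ae_eq hreg
  have hdomπ : M.Dominated π coordY coordX 2 M.Bound₁ := hπ ▸ hdom.map_path hY hX
  have hindπ : IndepFun (regressor s q coordY coordX 0)
      (M.residual coordY coordX M.ρ₀ M.θ₀ 0) π := by
    -- The residual equals `ε 0` only almost surely, which is enough for independence and for all
    -- integrals below.
    have h1 : IndepFun (regressor s q Y X 0) (M.residual Y X M.ρ₀ M.θ₀ 0) P :=
      hind.congr (EventuallyEq.refl _ _) hres.symm
    rw [indepFun_iff_measure_inter_preimage_eq_mul] at h1 ⊢
    intro A B hA hB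
    rw [hπ, Measure.map_apply hpm ((hZm hA).inter (hem hB)), Measure.map_apply hpm (hZm hA),
      Measure.map_apply hpm (hem hB)]
    exact h1 A B hA hB
  have he2 : MemLp (M.residual coordY coordX M.ρ₀ M.θ₀ 0) 2 π := by
    rw [hπ]
    exact (memLp_map_measure_iff hem.aestronglyMeasurable hpm.aemeasurable).2
      ((memLp_congr_ae hres).2 hnull.memLp_innovation)
  have hH2π : MemLp (fun w => H (regressor s q coordY coordX 0 w) /
      M.σ M.θ₀ (regressor s q coordY coordX 0 w)) 2 π := by
    rw [hπ]
    exact (memLp_map_measure_iff ((hH.comp hZm).div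
      ((hreg.meas_σ _ hθ₀).comp hZm)).aestronglyMeasurable hpm.aemeasurable).2 hH2
  have hg0π : ∫ w, g (M.residual coordY coordX M.ρ₀ M.θ₀ 0 w) ∂π = 0 := by
    rw [hπ, integral_map hpm.aemeasurable, ← hg0]
    · exact integral_congr_ae (hres.mono fun ω hω => congrArg g hω)
    · exact (hgm.comp hem).aestronglyMeasurable
  have hint := hdom.mem_interior
  have hK : ∀ j, ∫ w, M.meanTerm coordY coordX (M.residual coordY coordX M.ρ₀ M.θ₀) (deriv g) H j w
      ∂π = ∫ ω, M.meanTerm Y X ε (deriv g) H j ω ∂P := by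
    intro j
    rw [hπ, integral_map hpm.aemeasurable]
    · refine integral_congr_ae (hres.mono fun ω hω => ?_)
      simp only [Spec.meanTerm, ← hω]
      rfl
    · refine Measurable.aestronglyMeasurable ?_
      exact ((measurable_relative_partialDeriv_m hreg hint.1 hθ₀ j).comp hZm).mul
        (((hgm'.comp hem).mul (hH.comp hZm)).div ((hreg.meas_σ _ hθ₀).comp hZm))
  have hJ : ∀ k, ∫ w, M.scaleTerm coordY coordX (M.residual coordY coordX M.ρ₀ M.θ₀) (deriv g) H k w
      ∂π = ∫ ω, M.scaleTerm Y X ε (deriv g) H k ω ∂P := by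
    intro k
    rw [hπ, integral_map hpm.aemeasurable]
    · refine integral_congr_ae (hres.mono fun ω hω => ?_)
      simp only [Spec.scaleTerm, ← hω]
      rfl
    · refine Measurable.aestronglyMeasurable ?_
      exact ((measurable_relative_partialDeriv_σ hreg hint.2 k).comp hZm).mul
        (((hem.mul (hgm'.comp hem)).mul (hH.comp hZm)).div ((hreg.meas_σ _ hθ₀).comp hZm))
  refine tendstoInMeasure_of_locallyDiscrete (R := fun n ρ θ ω =>
    (M.stat Y X g H h n ρ θ ω - M.stat Y X g H h n M.ρ₀ M.θ₀ ω) -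
      (linForm n ρ M.ρ₀ (fun j => h * ∫ ω', M.meanTerm Y X ε (deriv g) H j ω' ∂P) +
        linForm n θ M.θ₀ (fun k => h * ∫ ω', M.scaleTerm Y X ε (deriv g) H k ω' ∂P)))
    hρcons hθcons hρdisc hθdisc fun u v huv => ?_
  have hmain := hreg.tendstoInMeasure_stat_sub (hπ ▸ hnull.ergodic) hdomπ hindπ he2 hH hH2π hg hg' hg''
    hg0π h huv
  simp only [hK, hJ] at hmain
  rw [hπ] at hmain
  have hmain' := hmain.zero_of_map hpm.aemeasurable
  simp only [hpath, stat_path] at hmain'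
  exact hmain'

end Null

end ArchModel

/-! ### The two statistics and the central sequence. -/

theorem proposition2 {s q d ℓ p : ℕ} (M : ArchModel.Spec s q d ℓ p)
    {Ω : Type*} [MeasurableSpace Ω] (P : Measure Ω) [IsProbabilityMeasure P]
    (Y : ℤ → Ω → ℝ) (X : ℤ → Ω → Fin d → ℝ) (ε : ℤ → Ω → ℝ)
    (hreg : M.Regular) (hnull : M.Null P Y X ε) (hscore : M.ScoreIdentities P ε)
    (hmom : M.Moments P Y X ε) (hdom : M.Domination P Y X)
    (h h' : ℝ)
    (ρhat : ℕ → Ω → ArchModel.Par ℓ) (θhat : ℕ → Ω → ArchModel.Par p)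
    (hρmeas : ∀ n, Measurable (ρhat n)) (hθmeas : ∀ n, Measurable (θhat n))
    (hρcons : ArchModel.RootNConsistent P ρhat M.ρ₀)
    (hθcons : ArchModel.RootNConsistent P θhat M.θ₀)
    (hρdisc : ArchModel.LocallyDiscrete ρhat M.ρ₀)
    (hθdisc : ArchModel.LocallyDiscrete θhat M.θ₀) :
    ((∀ j, Integrable (M.meanTerm Y X ε (deriv (ArchModel.score M.f)) M.G j) P) ∧
      (∀ j, Integrable (M.meanTerm Y X ε (deriv (ArchModel.scaleScore M.f)) M.S j) P) ∧
      (∀ k, Integrable (M.scaleTerm Y X ε (deriv (ArchModel.score M.f)) M.G k) P) ∧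
      (∀ k, Integrable (M.scaleTerm Y X ε (deriv (ArchModel.scaleScore M.f)) M.S k) P)) ∧
    TendstoInMeasure P (fun (n : ℕ) ω =>
      (M.rStat Y X h n (ρhat n ω) (θhat n ω) ω - M.rStat Y X h n M.ρ₀ M.θ₀ ω) -
        (ArchModel.linForm n (ρhat n ω) M.ρ₀ (fun j => h * M.K P Y X ε j) +
          ArchModel.linForm n (θhat n ω) M.θ₀ (fun k => h * M.J P Y X ε k)))
      atTop (fun _ => 0) ∧
    TendstoInMeasure P (fun (n : ℕ) ω =>
      (M.qStat Y X h' n (ρhat n ω) (θhat n ω) ω - M.qStat Y X h' n M.ρ₀ M.θ₀ ω) -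
        (ArchModel.linForm n (ρhat n ω) M.ρ₀ (fun j => h' * M.K' P Y X ε j) +
          ArchModel.linForm n (θhat n ω) M.θ₀ (fun k => h' * M.J' P Y X ε k)))
      atTop (fun _ => 0) ∧
    TendstoInMeasure P (fun (n : ℕ) ω =>
      (M.central Y X h h' n (ρhat n ω) (θhat n ω) ω - M.central Y X h h' n M.ρ₀ M.θ₀ ω) -
        M.D P Y X ε h h' ρhat θhat n ω)
      atTop (fun _ => 0) := by
  obtain ⟨lam, hlam, hG, hS, -⟩ := hmom
  have hZ : Measurable (ArchModel.regressor s q Y X 0) :=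
    ArchModel.measurable_regressor hnull.meas_Y hnull.meas_X 0
  have hσ := hreg.meas_σ _ hnull.θ₀_mem
  have hG2 := hG.memLp_two
    ((hreg.meas_G.comp hZ).div (hσ.comp hZ)).aestronglyMeasurable (by linarith)
  have hS2 := hS.memLp_two
    ((hreg.meas_S.comp hZ).div (hσ.comp hZ)).aestronglyMeasurable (by linarith)
  have hN : ArchModel.scaleScore M.f = fun x => 1 + x * ArchModel.score M.f x := rfl
  have hNd : Differentiable ℝ (ArchModel.scaleScore M.f) :=
    (differentiable_const 1).add (differentiable_id.mul hreg.diff_score)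
  have hNderiv : deriv (ArchModel.scaleScore M.f) =
      fun x => ArchModel.score M.f x + x * deriv (ArchModel.score M.f) x := by
    funext x
    have := ((hasDerivAt_id x).mul (hreg.diff_score x).hasDerivAt).const_add 1
    refine this.deriv.trans ?_
    simp
  have hNd' : Differentiable ℝ (deriv (ArchModel.scaleScore M.f)) := by
    rw [hNderiv]
    exact hreg.diff_score.add (differentiable_id.mul hreg.diff₂_score)
  -- Centring of `N_f(ε₀)` is the identity `E[ε₀ M_f(ε₀)] = -1`; integrability follows because this
  -- value is nonzero.
  have hN0 : ∫ ω, ArchModel.scaleScore M.f (ε 0 ω) ∂P = 0 := by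
    have hi : Integrable (fun ω => ε 0 ω * ArchModel.score M.f (ε 0 ω)) P := by
      by_contra hcon
      have := hscore.two
      rw [integral_undef hcon] at this
      norm_num at this
    simp only [hN]
    rw [integral_add (integrable_const _) hi, hscore.two]
    simp
  obtain ⟨hK, hJ, hr⟩ := hnull.tendstoInMeasure_stat_estimator hreg hdom.one hreg.meas_G hG2
    hreg.diff_score hreg.diff₂_score hreg.bdd_score hscore.one h hρcons hθcons hρdisc hθdisc
  obtain ⟨hK', hJ', hq⟩ := hnull.tendstoInMeasure_stat_estimator hreg hdom.one hreg.meas_S hS2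
    hNd hNd' hreg.bdd_scaleScore hN0 h' hρcons hθcons hρdisc hθdisc
  refine ⟨⟨hK, hK', hJ, hJ'⟩, hr, hq, ?_⟩
  refine (hr.zero_add hq).congr_left fun n => Eventually.of_forall fun ω => ?_
  have hr_eq : ∀ ρ θ, M.stat Y X (ArchModel.score M.f) M.G h n ρ θ ω = M.rStat Y X h n ρ θ ω :=
    fun _ _ => rfl
  have hq_eq : ∀ ρ θ, M.stat Y X (ArchModel.scaleScore M.f) M.S h' n ρ θ ω =
      M.qStat Y X h' n ρ θ ω := fun _ _ => rfl
  simp only [ArchModel.Spec.central, ArchModel.Spec.D, ArchModel.linForm_add, hr_eq, hq_eq,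
    ArchModel.Spec.K, ArchModel.Spec.K', ArchModel.Spec.J, ArchModel.Spec.J']
  ring
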